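/- Let abilities be distributed according to a law on $(0,\infty)$ with distribution function $F$ and finite mean, having a density $f$ that is continuous and positive on an open interval $I\subseteq(0,\infty)$ (bounded or not) and zero off $I$; let $F^{-1}:(0,1)\to I$ be the quantile function. Among $n$ contestants with i.i.d. abilities $x_1,\dots,x_n\sim F$ the $m$ ablest are admitted ($2\le m\le n$), and in the complete simple contest (unit budget, $m-1$ equal prizes $V_1=\dots=V_{m-1}=\frac1{m-1}$, $V_m=0$, cost of effort $g(e)=e$) an admitted contestant of ability $x$ exerts the effort $$b^*(x)=\int_0^x\frac{\sum_{l=1}^{m-1}\binom{n-1}{l-1}(n-l)(V_l-V_{l+1})F(t)^{n-l-1}(1-F(t))^{l-1}f(t)}{\sum_{j=1}^{m}\binom{n-1}{j-1}F(t)^{n-j}(1-F(t))^{j-1}}\,t\,dt ,$$ while eliminated contestants exert none. Let $S(m,n)=\mathbb E\big[\sum_{i\text{ admitted}}b^*(x_i)\big]$ be the ex-ante total effort, call $m\in\{2,\dots,n\}$ optimal for $n$ if it maximizes $S(\cdot,n)$ over $\{2,\dots,n\}$, and for $k\in(0,1)$ put $$\phi(k)=\int_0^{1-k}F^{-1}(q)\,\frac{q}{1-q}\,\frac{k}{1-k}\Big(\frac1q-\frac{k}{q(1-q)}\Big)dq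 .$$ 1. $S(m,n)/n$ converges to $\phi(m/n)$ at a rate independent of $k=m/n$: for every $\varepsilon>0$ there is $N$ such that $|S(m,n)/n-\phi(m/n)|\le\varepsilon$ for all $n\ge N$ and all $2\le m<n$. 2. $\phi$ attains its maximum over $(0,1)$, and each maximizer $k$ solves the first-order equation $$\int_k^1F^{-1}(1-q)\Big(\frac1q-\frac{2k-k^2}{q^2}\Big)dq=0 .\qquad(*)$$ 3. For every $\varepsilon>0$ there is $N$ such that for every $n\ge N$ and every $m$ optimal for $n$ there is a maximizer $k\in(0,1)$ of $\phi$ over $(0,1)$ (hence a solution of $(*)$) with $|m/n-k|<\varepsilon$. 4. If $\phi$ has only one maximizer over $(0,1)$, then there is $k^*\in(0,1)$, namely this maximizer, that solves $(*)$ and satisfies $\lim_{n\to\infty}m^*(n)/n=k^*$ for every choice of optimal sizes $m^*(n)$. In particular, if $(*)$ has only one solution $k^*$ in $(0,1)$, then $k^*$ is the maximizer of $\phi$ and $m^*(n)/n\to k^*$. -/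

import Mathlib

open MeasureTheory ProbabilityTheory Set Filter Topology

noncomputable section

/-- A distribution of the (strictly positive) ability level of a contestant: it has a probability
density `f` that is continuous and positive on an open interval `I ⊆ (0, ∞)`, bounded or not, and
that vanishes off `I`; its mean is finite. -/
structure AbilityDistribution where
  /-- the interval of possible abilities -/
  I : Set ℝ
  isOpen_I : IsOpen I
  ordConnected_I : I.OrdConnected
  I_subset : I ⊆ Ioi 0
  /-- the probability density -/
  f : ℝ → ℝ
  continuousOn_f : ContinuousOn f I
  f_pos : ∀ x ∈ I, 0 < f x
  f_zero : ∀ x, x ∉ I → f x = 0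
  integral_f : ∫ x, f x = 1
  integrable_mean : Integrable (fun x => x * f x)

namespace AbilityDistribution

variable (D : AbilityDistribution)

/-- The law on `ℝ` of the ability of a single registered contestant. -/
def law : Measure ℝ := volume.withDensity (fun x => ENNReal.ofReal (D.f x))

lemma f_nonneg (x : ℝ) : 0 ≤ D.f x := by
  by_cases hx : x ∈ D.I
  · exact (D.f_pos x hx).le
  · exact (D.f_zero x hx).ge

instance isProbabilityMeasure_law : IsProbabilityMeasure D.law := by
  have hint : Integrable D.f := by
    by_contra h
    have h1 := D.integral_f
    rw [integral_undef h] at h1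
    exact zero_ne_one h1
  refine ⟨?_⟩
  rw [law, withDensity_apply _ MeasurableSet.univ, Measure.restrict_univ,
    ← ofReal_integral_eq_lintegral_ofReal hint (Filter.Eventually.of_forall D.f_nonneg),
    D.integral_f, ENNReal.ofReal_one]

/-- The distribution function `F`. -/
def F (x : ℝ) : ℝ := cdf D.law x

/-- The quantile function `F⁻¹`; for `q ∈ (0, 1)` it is the unique `x ∈ I` with `F x = q`. -/
def Finv (q : ℝ) : ℝ := sInf {x : ℝ | q ≤ D.F x}

/-- The probability that a contestant of ability `x` is among the `m` ablest of `n` contestants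
(the normalization `J(F, n, m, x)` of the posterior beliefs). -/
def admitProb (n m : ℕ) (x : ℝ) : ℝ :=
  ∑ j ∈ Finset.Icc 1 m,
    ((n - 1).choose (j - 1) : ℝ) * D.F x ^ (n - j) * (1 - D.F x) ^ (j - 1)

/-- The symmetric effort function `b*` (closed formula for the equilibrium effort) of the contest
with `n` registered contestants, shortlist size `m`, prizes `V 1 ≥ V 2 ≥ … ≥ V m` and cost of
effort `g(e) = e`: a contestant of ability `x` exerts the effort `b*(x)`. -/
def effort (n m : ℕ) (V : ℕ → ℝ) (x : ℝ) : ℝ :=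
  ∫ t in (0 : ℝ)..x,
    (∑ l ∈ Finset.Icc 1 (m - 1),
      ((n - 1).choose (l - 1) : ℝ) * ((n : ℝ) - l) * (V l - V (l + 1)) *
        D.F t ^ (n - l - 1) * (1 - D.F t) ^ (l - 1) * D.f t) / D.admitProb n m t * t

/-- The ex-ante total effort of that contest: the abilities `x 0, …, x (n - 1)` are independent
with law `D.law`, the `m` ablest contestants are admitted and exert the effort `effort`, the
eliminated ones exert no effort. -/
def totalEffort (n m : ℕ) (V : ℕ → ℝ) : ℝ :=
  ∫ x : Fin n → ℝ,
    ∑ i, (if (Finset.univ.filter (fun j => x i < x j)).card < m then D.effort n m V (x i) else 0)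
    ∂(Measure.pi fun _ : Fin n => D.law)

/-- The prizes of the complete simple contest with shortlist size `m` and budget `1`:
`m - 1` equal prizes `1 / (m - 1)`, and `0` for the last rank. -/
def completeSimplePrize (m : ℕ) (l : ℕ) : ℝ := if l < m then 1 / ((m : ℝ) - 1) else 0

/-- `S(m, n)`: the ex-ante total effort of the complete simple contest with shortlist size `m`
and `n` registered contestants. -/
def S (m n : ℕ) : ℝ := D.totalEffort n m (completeSimplePrize m)

/-- `m` is an optimal shortlist size among the complete simple contests with `n` registered
contestants. -/
def IsOptimalSize (n m : ℕ) : Prop :=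
  2 ≤ m ∧ m ≤ n ∧ ∀ m', 2 ≤ m' → m' ≤ n → D.S m' n ≤ D.S m n

/-- The limit function `φ`. -/
def phi (k : ℝ) : ℝ :=
  ∫ q in (0 : ℝ)..(1 - k),
    D.Finv q * (q / (1 - q)) * (k / (1 - k)) * (1 / q - k / (q * (1 - q)))

/-- `k` solves the first-order equation. -/
def FirstOrder (k : ℝ) : Prop :=
  ∫ q in k..(1 : ℝ), D.Finv (1 - q) * (1 / q - (2 * k - k ^ 2) / q ^ 2) = 0

end AbilityDistribution

end

/-! The total effort becomes an integral against the quantile function. An ability at quantile `p`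
is admitted with probability `binomLT (n - 1) m p`, and its effort is an integral over quantiles `q
≤ p`. Exchanging the order of integration (`S_div_eq`) gives `S(m,n)/n = ∫ F⁻¹(q) weight n m q dq`.
The weight is a product of two factors in `[0,1]`: the share of the last term in a truncated
binomial sum, and the normalized mean `E min(m, B) / (n(1-q))` with `B` binomial of mean `n(1-q)`.

For fixed `q` both factors converge uniformly in `m`. The truncated mean is handled by a variance
bound (`abs_truncMean_sub_le`). The share `R_i` satisfies `R_{i+1} = R_i / (R_i + ρ_{i+1})` with `ρ`
increasing, and it follows the slowly moving fixed point `max(1 - ρ_i, 0)`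
(`exists_abs_tailRatio_sub_limRatio_le`). Since `F⁻¹` is integrable and dominates every integrand,
dominated convergence along pairs `(n, m)` turns this into uniform convergence to `φ`.

The limit extends to a continuous function `phiExt` on `[0,1]` that vanishes at both ends and is
positive at `1/2`, so its maximum is interior. Writing `φ(k) = k/(1-k) · phiFactor k` and
differentiating under the integral yields the first-order equation. Compactness of `[0,1]` then
forces optimal relative sizes towards the maximizers: away from them `phiExt` stays a fixed amount
below its maximum. -/

noncomputable section

/-! ### Distribution function and quantile transform -/

namespace AbilityDistribution

variable (D : AbilityDistribution)

lemma integrable_f : Integrable D.f := by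
  by_contra h
  have h1 := D.integral_f
  rw [integral_undef h] at h1
  exact zero_ne_one h1

lemma F_eq_real (x : ℝ) : D.F x = D.law.real (Iic x) := cdf_eq_real _ x

lemma F_nonneg (x : ℝ) : 0 ≤ D.F x := cdf_nonneg _ x

lemma F_le_one (x : ℝ) : D.F x ≤ 1 := cdf_le_one _ x

lemma monotone_F : Monotone D.F := monotone_cdf _

lemma law_singleton (x : ℝ) : D.law {x} = 0 :=
  withDensity_absolutelyContinuous _ _ Real.volume_singleton

lemma continuous_F : Continuous D.F := by
  refine continuous_iff_continuousAt.2 fun x => ?_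
  have h := D.law_singleton x
  rw [← measure_cdf D.law, StieltjesFunction.measure_singleton, ENNReal.ofReal_eq_zero,
    sub_nonpos] at h
  have h2 : Function.leftLim (cdf D.law) x = cdf D.law x :=
    le_antisymm ((monotone_cdf D.law).leftLim_le le_rfl) h
  refine ((monotone_cdf D.law).continuousAt_iff_leftLim_eq_rightLim).2 ?_
  rw [h2, StieltjesFunction.rightLim_eq]

lemma F_zero : D.F 0 = 0 := by
  have : D.law (Iic 0) = 0 := by
    rw [law, withDensity_apply _ measurableSet_Iic, setLIntegral_congr_fun (g := fun _ => 0)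
      measurableSet_Iic]
    · simp
    · intro x hx
      have : D.f x = 0 := D.f_zero x fun h => absurd (mem_Ioi.1 (D.I_subset h)) (not_lt.2 hx)
      simp [this]
  rw [F_eq_real, measureReal_def, this, ENNReal.toReal_zero]

lemma exists_F_eq {q : ℝ} (hq : q ∈ Ioo (0 : ℝ) 1) : ∃ x, D.F x = q :=
  mem_range_of_exists_le_of_exists_ge D.continuous_F
    (((tendsto_cdf_atBot D.law).eventually_le_const hq.1).exists)
    (((tendsto_cdf_atTop D.law).eventually_const_le hq.2).exists)

lemma bddBelow_le_F {q : ℝ} (hq : 0 < q) : BddBelow {x : ℝ | q ≤ D.F x} := by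
  refine ⟨0, fun x hx => ?_⟩
  by_contra! h
  have := D.monotone_F h.le
  rw [F_zero] at this
  exact absurd (hq.trans_le hx) (not_lt.2 this)

lemma F_Finv {q : ℝ} (hq : q ∈ Ioo (0 : ℝ) 1) : D.F (D.Finv q) = q := by
  obtain ⟨y, hy⟩ := D.exists_F_eq hq
  refine le_antisymm ?_ ?_
  · rw [← hy]
    exact D.monotone_F (hy ▸ csInf_le (D.bddBelow_le_F hq.1) hy.ge)
  · exact (isClosed_le continuous_const D.continuous_F).csInf_mem ⟨y, hy.ge⟩
      (D.bddBelow_le_F hq.1)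

lemma Finv_le_iff {q : ℝ} (hq : q ∈ Ioo (0 : ℝ) 1) (x : ℝ) : D.Finv q ≤ x ↔ q ≤ D.F x := by
  constructor
  · intro h
    exact (D.F_Finv hq).symm.le.trans (D.monotone_F h)
  · intro h
    exact csInf_le (D.bddBelow_le_F hq.1) h

lemma Finv_pos {q : ℝ} (hq : q ∈ Ioo (0 : ℝ) 1) : 0 < D.Finv q := by
  by_contra! h
  have := (D.Finv_le_iff hq 0).1 h
  rw [F_zero] at this
  exact absurd hq.1 (not_lt.2 this)

lemma monotoneOn_Finv : MonotoneOn D.Finv (Ioo 0 1) := by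
  intro p hp q hq hpq
  rw [D.Finv_le_iff hp, D.F_Finv hq]
  exact hpq

lemma aemeasurable_Finv : AEMeasurable D.Finv (volume.restrict (Ioo 0 1)) :=
  aemeasurable_restrict_of_monotoneOn measurableSet_Ioo D.monotoneOn_Finv

/-- Inverse transform sampling: by `Finv_le_iff` the preimage of `Iic x` is, within `(0,1)`, the set
of `q ≤ F x`, of length `F x`. -/
lemma map_Finv : (volume.restrict (Ioo (0 : ℝ) 1)).map D.Finv = D.law := by
  have : IsFiniteMeasure ((volume.restrict (Ioo (0 : ℝ) 1)).map D.Finv) := inferInstance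
  refine Measure.ext_of_Iic _ _ fun x => ?_
  rw [Measure.map_apply_of_aemeasurable D.aemeasurable_Finv measurableSet_Iic,
    ← ofReal_cdf D.law x]
  have h1 : volume.restrict (Ioo (0 : ℝ) 1) (D.Finv ⁻¹' Iic x)
      = volume.restrict (Ioo (0 : ℝ) 1) (Iic (D.F x)) := by
    refine measure_congr ?_
    filter_upwards [ae_restrict_mem measurableSet_Ioo] with q hq
    exact propext (D.Finv_le_iff hq x)
  have h2 : Ioo (0 : ℝ) (D.F x) ⊆ Iic (D.F x) ∩ Ioo 0 1 := fun y hy =>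
    ⟨hy.2.le, hy.1, hy.2.trans_le (D.F_le_one x)⟩
  have h3 : Iic (D.F x) ∩ Ioo (0 : ℝ) 1 ⊆ Ioc 0 (D.F x) := fun y hy => ⟨hy.2.1, hy.1⟩
  rw [h1, Measure.restrict_apply measurableSet_Iic]
  refine le_antisymm ((measure_mono h3).trans ?_) (le_trans ?_ (measure_mono h2))
  · rw [Real.volume_Ioc, sub_zero]; rfl
  · rw [Real.volume_Ioo, sub_zero]; rfl

lemma integral_law_eq_integral_Finv {G : ℝ → ℝ} (hG : Measurable G) :
    ∫ x, G x ∂D.law = ∫ q in Ioo (0 : ℝ) 1, G (D.Finv q) := by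
  conv_lhs => rw [← D.map_Finv]
  exact integral_map D.aemeasurable_Finv hG.aestronglyMeasurable

lemma aemeasurable_ofReal_f : AEMeasurable (fun x => ENNReal.ofReal (D.f x)) volume :=
  D.integrable_f.aestronglyMeasurable.aemeasurable.ennreal_ofReal

lemma setIntegral_law_eq {G : ℝ → ℝ} {s : Set ℝ} (hs : MeasurableSet s) :
    ∫ x in s, G x ∂D.law = ∫ x in s, G x * D.f x := by
  rw [law, setIntegral_withDensity_eq_setIntegral_toReal_smul₀
    D.aemeasurable_ofReal_f.restrict (by simp) G hs]
  refine integral_congr_ae (Eventually.of_forall fun x => ?_)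
  simp [ENNReal.toReal_ofReal (D.f_nonneg x), mul_comm]

lemma integrable_id_law : Integrable (fun x => x) D.law := by
  rw [law, integrable_withDensity_iff_integrable_smul₀' D.aemeasurable_ofReal_f (by simp)]
  refine D.integrable_mean.congr (Eventually.of_forall fun x => ?_)
  simp [ENNReal.toReal_ofReal (D.f_nonneg x), mul_comm]

lemma integrableOn_Finv : IntegrableOn D.Finv (Ioo 0 1) := by
  have h := D.integrable_id_law
  rw [← D.map_Finv] at h
  exact h.comp_aemeasurable D.aemeasurable_Finv

end AbilityDistribution

/-! ### Binomial terms and the recursion for their tail ratio -/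

/-- The probability of `i` successes in `N` trials with failure probability `q`. -/
def binomTerm (N i : ℕ) (q : ℝ) : ℝ := (N.choose i : ℝ) * q ^ (N - i) * (1 - q) ^ i

/-- The probability of fewer than `m` successes in `N` trials with failure probability `q`. -/
def binomLT (N m : ℕ) (q : ℝ) : ℝ := ∑ i ∈ Finset.range m, binomTerm N i q

/-- The share of the `i`-th term in the sum of the first `i + 1` terms of the binomial law. -/
def tailRatio (N i : ℕ) (q : ℝ) : ℝ := binomTerm N i q / binomLT N (i + 1) q

lemma continuous_binomTerm (N i : ℕ) : Continuous (binomTerm N i) := by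
  unfold binomTerm; fun_prop

lemma continuous_binomLT (N m : ℕ) : Continuous (binomLT N m) := by
  unfold binomLT
  exact continuous_finsetSum _ fun i _ => continuous_binomTerm N i

lemma binomTerm_eq_eval (N i : ℕ) (q : ℝ) :
    binomTerm N i q = (bernsteinPolynomial ℝ N i).eval (1 - q) := by
  simp [binomTerm, bernsteinPolynomial]
  ring

lemma binomTerm_nonneg (N i : ℕ) {q : ℝ} (hq : q ∈ Icc (0 : ℝ) 1) : 0 ≤ binomTerm N i q := by
  have := hq.1
  have : 0 ≤ 1 - q := sub_nonneg.2 hq.2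
  unfold binomTerm; positivity

lemma binomTerm_pos {N i : ℕ} (hi : i ≤ N) {q : ℝ} (hq : q ∈ Ioo (0 : ℝ) 1) :
    0 < binomTerm N i q := by
  have := hq.1
  have : 0 < 1 - q := sub_pos.2 hq.2
  have := Nat.choose_pos hi
  unfold binomTerm; positivity

lemma binomLT_nonneg (N m : ℕ) {q : ℝ} (hq : q ∈ Icc (0 : ℝ) 1) : 0 ≤ binomLT N m q :=
  Finset.sum_nonneg fun i _ => binomTerm_nonneg N i hq

lemma sum_binomTerm (N : ℕ) (q : ℝ) : ∑ i ∈ Finset.range (N + 1), binomTerm N i q = 1 := by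
  have := congrArg (Polynomial.eval (1 - q)) (bernsteinPolynomial.sum ℝ N)
  rw [Polynomial.eval_finsetSum, Polynomial.eval_one] at this
  simpa only [binomTerm_eq_eval] using this

lemma binomLT_le_one {N m : ℕ} (hm : m ≤ N + 1) {q : ℝ} (hq : q ∈ Icc (0 : ℝ) 1) :
    binomLT N m q ≤ 1 := by
  rw [← sum_binomTerm N q]
  exact Finset.sum_le_sum_of_subset_of_nonneg (Finset.range_mono hm)
    fun i _ _ => binomTerm_nonneg N i hq

lemma binomLT_succ (N m : ℕ) (q : ℝ) : binomLT N (m + 1) q = binomLT N m q + binomTerm N m q :=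
  Finset.sum_range_succ _ _

lemma binomLT_pos {N m : ℕ} (hm : 1 ≤ m) {q : ℝ} (hq : q ∈ Ioo (0 : ℝ) 1) :
    0 < binomLT N m q := by
  have hq' : q ∈ Icc (0 : ℝ) 1 := Ioo_subset_Icc_self hq
  exact (binomTerm_pos (Nat.zero_le N) hq).trans_le
    (Finset.single_le_sum (f := fun i => binomTerm N i q)
      (fun i _ => binomTerm_nonneg N i hq') (Finset.mem_range.2 hm))

lemma tailRatio_zero {N : ℕ} {q : ℝ} (hq : q ∈ Ioo (0 : ℝ) 1) : tailRatio N 0 q = 1 := by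
  have : binomLT N 1 q = binomTerm N 0 q := by simp [binomLT]
  rw [tailRatio, zero_add, this, div_self (binomTerm_pos (Nat.zero_le N) hq).ne']

lemma tailRatio_nonneg (N i : ℕ) {q : ℝ} (hq : q ∈ Icc (0 : ℝ) 1) : 0 ≤ tailRatio N i q :=
  div_nonneg (binomTerm_nonneg _ _ hq) (binomLT_nonneg _ _ hq)

lemma tailRatio_le_one (N i : ℕ) {q : ℝ} (hq : q ∈ Icc (0 : ℝ) 1) : tailRatio N i q ≤ 1 := by
  refine div_le_one_of_le₀ ?_ (binomLT_nonneg _ _ hq)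
  rw [binomLT_succ]
  exact le_add_of_nonneg_left (binomLT_nonneg _ _ hq)

lemma tailRatio_pos {N i : ℕ} (hi : i ≤ N) {q : ℝ} (hq : q ∈ Ioo (0 : ℝ) 1) :
    0 < tailRatio N i q :=
  div_pos (binomTerm_pos hi hq) (binomLT_pos (Nat.succ_pos i) hq)

/-- The quotient of two consecutive terms of the binomial law with `n - 1` trials. -/
def termQuot (n : ℕ) (q : ℝ) (i : ℕ) : ℝ := i / ((n : ℝ) - i) * (q / (1 - q))

lemma binomTerm_eq_termQuot_mul {N i : ℕ} (hi : i < N) {q : ℝ} (hq : q ∈ Ioo (0 : ℝ) 1) :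
    binomTerm N i q = termQuot (N + 1) q (i + 1) * binomTerm N (i + 1) q := by
  have h1 : (1 - q) ≠ 0 := (sub_pos.2 hq.2).ne'
  have h2 : ((N : ℝ) - i) ≠ 0 := sub_ne_zero.2 (by exact_mod_cast hi.ne')
  have h3 : (N.choose (i + 1) : ℝ) * (i + 1) = N.choose i * (N - i) := by
    have := Nat.choose_succ_right_eq N i
    rw [← Nat.cast_sub hi.le]
    exact_mod_cast this
  obtain ⟨d, rfl⟩ : ∃ d, N = i + 1 + d := ⟨N - (i + 1), by omega⟩
  have e1 : i + 1 + d - i = d + 1 := by omega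
  have e2 : i + 1 + d - (i + 1) = d := by omega
  have h4 : ((i + 1 + d : ℕ) : ℝ) - i = d + 1 := by push_cast; ring
  rw [h4] at h2 h3
  have h5 : ((i + 1 + d + 1 : ℕ) : ℝ) - ((i + 1 : ℕ) : ℝ) = d + 1 := by push_cast; ring
  rw [termQuot, binomTerm, binomTerm, e1, e2, h5]
  push_cast
  field_simp
  linear_combination (-(q * q ^ d * (1 - q) ^ (i + 1))) * h3

lemma tailRatio_succ {N i : ℕ} (hi : i < N) {q : ℝ} (hq : q ∈ Ioo (0 : ℝ) 1) :
    tailRatio N (i + 1) q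
      = tailRatio N i q / (tailRatio N i q + termQuot (N + 1) q (i + 1)) := by
  have h1 := binomTerm_pos (show i + 1 ≤ N from hi) hq
  have h2 := binomLT_pos (N := N) (Nat.succ_pos i) hq
  have h0 := binomTerm_pos hi.le hq
  have h3 := binomTerm_eq_termQuot_mul hi hq
  have hρ : 0 < termQuot (N + 1) q (i + 1) := by
    by_contra! h
    exact absurd h0 (not_lt.2 (h3 ▸ mul_nonpos_of_nonpos_of_nonneg h h1.le))
  rw [tailRatio, tailRatio, binomLT_succ N (i + 1)]
  rw [h3]
  set ρ := termQuot (N + 1) q (i + 1)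
  set t := binomTerm N (i + 1) q
  set J := binomLT N (i + 1) q
  have : J + t ≠ 0 := (add_pos h2 h1).ne'
  have : ρ * t / J + ρ ≠ 0 := by positivity
  field_simp
  ring

lemma termQuot_mono {n : ℕ} {q : ℝ} (hq : q ∈ Ioo (0 : ℝ) 1) {i j : ℕ} (hij : i ≤ j)
    (hj : j < n) : termQuot n q i ≤ termQuot n q j := by
  have h1 : 0 < 1 - q := sub_pos.2 hq.2
  have h2 : (0 : ℝ) < n - j := sub_pos.2 (by exact_mod_cast hj)
  have h3 : (i : ℝ) ≤ j := by exact_mod_cast hij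
  have := hq.1
  unfold termQuot
  gcongr

lemma termQuot_nonneg {n : ℕ} {q : ℝ} (hq : q ∈ Ioo (0 : ℝ) 1) {j : ℕ}
    (hj : j < n) : 0 ≤ termQuot n q j := by
  have := termQuot_mono hq (Nat.zero_le j) hj
  simpa [termQuot] using this

/-- The map `x ↦ x / (x + ρ)` is increasing and fixes `1 - ρ`. Since `ρ` grows with the index, a
ratio above the old fixed point is above the new one, and so is its image. -/
lemma one_sub_termQuot_le_tailRatio {N i : ℕ} (hi : i ≤ N) {q : ℝ} (hq : q ∈ Ioo (0 : ℝ) 1) :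
    1 - termQuot (N + 1) q i ≤ tailRatio N i q := by
  induction i with
  | zero => rw [tailRatio_zero hq]; simp [termQuot]
  | succ i ih =>
    have h1 := ih (by omega)
    have h2 := termQuot_mono (n := N + 1) hq (Nat.le_succ i) (by omega)
    have h3 := tailRatio_pos (show i ≤ N by omega) hq
    have h4 : 0 ≤ termQuot (N + 1) q (i + 1) := termQuot_nonneg hq (by omega)
    rw [tailRatio_succ hi hq, le_div_iff₀ (by positivity)]
    simp only [Nat.succ_eq_add_one] at h2
    nlinarith

/-- By the fixed-point bound the denominator in the recursion is at least `1`. -/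
lemma tailRatio_succ_le {N i : ℕ} (hi : i < N) {q : ℝ} (hq : q ∈ Ioo (0 : ℝ) 1) :
    tailRatio N (i + 1) q ≤ tailRatio N i q := by
  have h1 := one_sub_termQuot_le_tailRatio hi.le hq
  have h2 := termQuot_mono (n := N + 1) hq (Nat.le_succ i) (by omega)
  have h3 := tailRatio_pos hi.le hq
  simp only [Nat.succ_eq_add_one] at h2
  rw [tailRatio_succ hi hq]
  exact div_le_self h3.le (by linarith)

lemma tailRatio_anti {N i j : ℕ} (hij : i ≤ j) (hj : j ≤ N) {q : ℝ} (hq : q ∈ Ioo (0 : ℝ) 1) :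
    tailRatio N j q ≤ tailRatio N i q := by
  induction j, hij using Nat.le_induction with
  | base => exact le_rfl
  | succ j _ ih => exact (tailRatio_succ_le hj hq).trans (ih (by omega))

/-- Descent of the tail ratio over `K` consecutive indices. -/
lemma mul_tailRatio_mul_le_one {N a K : ℕ} (h : a + K ≤ N) {q : ℝ} (hq : q ∈ Ioo (0 : ℝ) 1) :
    K * (tailRatio N (a + K) q * (tailRatio N (a + K) q - (1 - termQuot (N + 1) q a))) ≤ 1 := by
  set b := tailRatio N (a + K) q with hb
  have hb0 : 0 < b := tailRatio_pos h hq
  rcases le_total (b - (1 - termQuot (N + 1) q a)) 0 with hneg | hpos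
  · have : b * (b - (1 - termQuot (N + 1) q a)) ≤ 0 := mul_nonpos_of_nonneg_of_nonpos hb0.le hneg
    exact (mul_nonpos_of_nonneg_of_nonpos (Nat.cast_nonneg K) this).trans zero_le_one
  -- The recursion reads `R_j - R_{j+1} = R_{j+1} (R_j - (1 - ρ_{j+1}))`. By monotonicity of `R` and
  -- `ρ`, each of the `K` steps therefore drops by at least the same amount, while the total drop is
  -- at most `1`.
  have key : ∀ d ≤ K, d * (b * (b - (1 - termQuot (N + 1) q a)))
      ≤ tailRatio N a q - tailRatio N (a + d) q := by
    intro d hd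
    induction d with
    | zero => simp
    | succ d ih =>
      have h0 := ih (by omega)
      have h1 : b ≤ tailRatio N (a + (d + 1)) q := tailRatio_anti (by omega) h hq
      have h2 : tailRatio N (a + (d + 1)) q ≤ tailRatio N (a + d) q :=
        tailRatio_succ_le (i := a + d) (by omega) hq
      have h3 := termQuot_mono (n := N + 1) hq (show a ≤ a + d + 1 by omega) (by omega)
      have h4 := tailRatio_succ (show a + d < N by omega) hq
      have h5 : 0 < tailRatio N (a + d) q := tailRatio_pos (by omega) hq
      have h6 : 0 ≤ termQuot (N + 1) q (a + d + 1) := termQuot_nonneg hq (by omega)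
      rw [eq_div_iff (by positivity)] at h4
      have h7 : b * (b - (1 - termQuot (N + 1) q a)) ≤ tailRatio N (a + (d + 1)) q *
          (tailRatio N (a + d) q - (1 - termQuot (N + 1) q (a + d + 1))) := by
        refine mul_le_mul h1 ?_ hpos (hb0.le.trans h1)
        linarith
      have h8 : tailRatio N (a + (d + 1)) q = tailRatio N (a + d + 1) q := rfl
      rw [h8] at h7 ⊢
      push_cast
      linarith
  have h1 := key K le_rfl
  have h2 := tailRatio_le_one N a (Ioo_subset_Icc_self hq)
  linarith

/-! ### Truncated binomial mean -/

/-- The mean of the minimum of `m` and a binomial variable with `n` trials and failure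
probability `q`. -/
def truncMean (n m : ℕ) (q : ℝ) : ℝ :=
  ∑ i ∈ Finset.range (n + 1), min (i : ℝ) m * binomTerm n i q

lemma sum_mul_binomTerm (n : ℕ) (q : ℝ) :
    ∑ i ∈ Finset.range (n + 1), (i : ℝ) * binomTerm n i q = n * (1 - q) := by
  have := congrArg (Polynomial.eval (1 - q)) (bernsteinPolynomial.sum_smul ℝ n)
  simpa [Polynomial.eval_finsetSum, ← binomTerm_eq_eval] using this

lemma sum_sq_mul_binomTerm (n : ℕ) (q : ℝ) :
    ∑ i ∈ Finset.range (n + 1), ((n : ℝ) * (1 - q) - i) ^ 2 * binomTerm n i q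
      = n * (1 - q) * q := by
  have := congrArg (Polynomial.eval (1 - q)) (bernsteinPolynomial.variance ℝ n)
  simpa [Polynomial.eval_finsetSum, ← binomTerm_eq_eval] using this

lemma truncMean_nonneg (n m : ℕ) {q : ℝ} (hq : q ∈ Icc (0 : ℝ) 1) : 0 ≤ truncMean n m q :=
  Finset.sum_nonneg fun i _ => mul_nonneg (by positivity) (binomTerm_nonneg n i hq)

lemma truncMean_le (n m : ℕ) {q : ℝ} (hq : q ∈ Icc (0 : ℝ) 1) :
    truncMean n m q ≤ n * (1 - q) := by
  rw [← sum_mul_binomTerm]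
  exact Finset.sum_le_sum fun i _ =>
    mul_le_mul_of_nonneg_right (min_le_left _ _) (binomTerm_nonneg n i hq)

lemma continuous_truncMean (n m : ℕ) : Continuous (truncMean n m) := by
  unfold truncMean
  exact continuous_finsetSum _ fun i _ => continuous_const.mul (continuous_binomTerm n i)

/-- Truncation at `m` is 1-Lipschitz, so the error is at most the mean absolute deviation of the
binomial variable. This is bounded through `x ≤ x²/(2s) + s/2` with `s = √n` and the variance `n q
(1-q)`. -/
lemma abs_truncMean_sub_le {n m : ℕ} (hn : 1 ≤ n) {q : ℝ} (hq : q ∈ Icc (0 : ℝ) 1) :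
    |truncMean n m q - min (m : ℝ) (n * (1 - q))| ≤ √n := by
  have hn' : (0 : ℝ) < n := by exact_mod_cast hn
  set s := √(n : ℝ) with hs
  have hs0 : 0 < s := Real.sqrt_pos.2 hn'
  have hss : s * s = n := Real.mul_self_sqrt hn'.le
  have h1 : min (m : ℝ) (n * (1 - q))
      = ∑ i ∈ Finset.range (n + 1), min (m : ℝ) (n * (1 - q)) * binomTerm n i q := by
    rw [← Finset.mul_sum, sum_binomTerm, mul_one]
  rw [h1, truncMean, ← Finset.sum_sub_distrib]
  refine (Finset.abs_sum_le_sum_abs _ _).trans ?_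
  have h2 : ∀ i ∈ Finset.range (n + 1),
      |min (i : ℝ) m * binomTerm n i q - min (m : ℝ) (n * (1 - q)) * binomTerm n i q|
        ≤ (2 * s)⁻¹ * (((n : ℝ) * (1 - q) - i) ^ 2 * binomTerm n i q)
          + s / 2 * binomTerm n i q := by
    intro i _
    have hb := binomTerm_nonneg n i hq
    rw [← sub_mul, abs_mul, abs_of_nonneg hb, ← mul_assoc, ← add_mul]
    refine mul_le_mul_of_nonneg_right ?_ hb
    have h3 : |min (i : ℝ) m - min (m : ℝ) (n * (1 - q))| ≤ |(n : ℝ) * (1 - q) - i| := by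
      rw [min_comm (i : ℝ), abs_sub_comm]
      refine (abs_min_sub_min_le_max _ _ _ _).trans ?_
      simp
    refine h3.trans ?_
    set x := |(n : ℝ) * (1 - q) - i| with hx
    rw [← sq_abs, ← hx]
    have : (2 * s)⁻¹ * x ^ 2 + s / 2 - x = (2 * s)⁻¹ * (x - s) ^ 2 := by
      field_simp; ring
    have h5 : 0 ≤ (2 * s)⁻¹ * (x - s) ^ 2 := by positivity
    linarith
  refine (Finset.sum_le_sum h2).trans ?_
  rw [Finset.sum_add_distrib, ← Finset.mul_sum, ← Finset.mul_sum, sum_sq_mul_binomTerm,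
    sum_binomTerm, ← hss]
  have h6 : (1 - q) * q ≤ 1 := by nlinarith [hq.1, hq.2]
  have h7 : (2 * s)⁻¹ * (s * s * (1 - q) * q) = s / 2 * ((1 - q) * q) := by
    field_simp
  rw [h7]
  nlinarith

/-- The derivative of a Bernstein polynomial is a difference of two consecutive ones of lower
degree. Summation by parts moves the difference onto `min i m`, whose increment is `1` for `i < m`
and `0` afterwards. -/
lemma hasDerivAt_truncMean {N m : ℕ} (hm : m ≤ N + 1) (q : ℝ) :
    HasDerivAt (truncMean (N + 1) m) (-((N + 1 : ℝ) * binomLT N m q)) q := by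
  have hT : ∀ i, HasDerivAt (binomTerm (N + 1) (i + 1))
      (-((N + 1 : ℝ) * (binomTerm N i q - binomTerm N (i + 1) q))) q := by
    intro i
    have h1 := (bernsteinPolynomial ℝ (N + 1) (i + 1)).hasDerivAt (1 - q)
    rw [bernsteinPolynomial.derivative_succ] at h1
    have h2 := h1.comp q ((hasDerivAt_id q).const_sub 1)
    simp only [Polynomial.eval_mul, Polynomial.eval_sub, Nat.add_sub_cancel,
      ← binomTerm_eq_eval] at h2
    have h3 : binomTerm (N + 1) (i + 1) =
        (fun x => Polynomial.eval x (bernsteinPolynomial ℝ (N + 1) (i + 1))) ∘ HSub.hSub 1 :=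
      funext fun x => binomTerm_eq_eval _ _ x
    rw [h3]
    exact h2.congr_deriv (by simp)
  have h1 : truncMean (N + 1) m = fun x =>
      ∑ i ∈ Finset.range (N + 1), min ((i + 1 : ℕ) : ℝ) m * binomTerm (N + 1) (i + 1) x := by
    funext x
    rw [truncMean, Finset.sum_range_succ']
    simp
  rw [h1]
  have h2 := HasDerivAt.fun_sum (u := Finset.range (N + 1)) fun i _ =>
    (hT i).const_mul (min ((i + 1 : ℕ) : ℝ) (m : ℝ))
  refine h2.congr_deriv ?_
  have h3 : ∑ i ∈ Finset.range (N + 1), min ((i + 1 : ℕ) : ℝ) (m : ℝ) * binomTerm N (i + 1) q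
      = ∑ i ∈ Finset.range (N + 1), min (i : ℝ) m * binomTerm N i q := by
    have ha := Finset.sum_range_succ' (fun i : ℕ => min (i : ℝ) m * binomTerm N i q) (N + 1)
    have hb := Finset.sum_range_succ (fun i : ℕ => min (i : ℝ) m * binomTerm N i q) (N + 1)
    have hc : binomTerm N (N + 1) q = 0 := by simp [binomTerm]
    rw [hb] at ha
    simpa [hc] using ha.symm
  have h4 : ∑ i ∈ Finset.range (N + 1), (min ((i + 1 : ℕ) : ℝ) m - min (i : ℝ) m)
      * binomTerm N i q = binomLT N m q := by
    rw [binomLT, ← Finset.sum_subset (Finset.range_mono hm)]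
    · refine Finset.sum_congr rfl fun i hi => ?_
      have : i + 1 ≤ m := Finset.mem_range.1 hi
      have h5 : ((i + 1 : ℕ) : ℝ) ≤ m := by exact_mod_cast this
      have h6 : (i : ℝ) ≤ m := by exact_mod_cast (by omega : i ≤ m)
      rw [min_eq_left h5, min_eq_left h6]
      push_cast; ring
    · intro i _ hi
      have : m ≤ i := not_lt.1 fun h => hi (Finset.mem_range.2 h)
      have h5 : (m : ℝ) ≤ ((i + 1 : ℕ) : ℝ) := by exact_mod_cast (by omega : m ≤ i + 1)
      have h6 : (m : ℝ) ≤ i := by exact_mod_cast this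
      rw [min_eq_right h5, min_eq_right h6]
      ring
  simp only [sub_mul, Finset.sum_sub_distrib] at h4
  rw [← h4, ← h3, ← Finset.sum_sub_distrib, Finset.mul_sum, ← Finset.sum_neg_distrib]
  refine Finset.sum_congr rfl fun i _ => ?_
  ring

lemma integral_binomLT {N m : ℕ} (hm : m ≤ N + 1) (q : ℝ) :
    ∫ p in q..1, binomLT N m p = truncMean (N + 1) m q / (N + 1) := by
  have h0 : truncMean (N + 1) m 1 = 0 := by
    refine Finset.sum_eq_zero fun i _ => ?_
    rcases i with _ | i <;> simp [binomTerm]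
  have h1 := intervalIntegral.integral_eq_sub_of_hasDerivAt (a := q) (b := 1)
    (fun x _ => hasDerivAt_truncMean hm x)
    ((((continuous_binomLT N m).const_mul _).neg).intervalIntegrable _ _)
  rw [intervalIntegral.integral_neg, intervalIntegral.integral_const_mul, h0] at h1
  have : (N + 1 : ℝ) ≠ 0 := by positivity
  rw [eq_div_iff this]
  linarith

/-! ### Pointwise limits, uniform in the shortlist size -/

/-- The limit of the tail ratio. -/
def limRatio (k q : ℝ) : ℝ := max (1 - q - k) 0 / ((1 - q) * (q + max (1 - q - k) 0))

lemma limRatio_nonneg (k : ℝ) {q : ℝ} (hq : q ∈ Ioo (0 : ℝ) 1) : 0 ≤ limRatio k q := by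
  have := hq.1
  have : 0 < 1 - q := sub_pos.2 hq.2
  unfold limRatio; positivity

lemma limRatio_le_one {k : ℝ} (hk : 0 ≤ k) {q : ℝ} (hq : q ∈ Ioo (0 : ℝ) 1) :
    limRatio k q ≤ 1 := by
  have h0 := hq.1
  have h1 : 0 < 1 - q := sub_pos.2 hq.2
  have h2 : max (1 - q - k) 0 ≤ 1 - q := max_le (by linarith) h1.le
  have h3 : 0 ≤ max (1 - q - k) 0 := le_max_right _ _
  unfold limRatio
  exact div_le_one_of_le₀ (by nlinarith) (by positivity)

lemma continuous_limRatio {q : ℝ} (hq : q ∈ Ioo (0 : ℝ) 1) :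
    Continuous fun k => limRatio k q := by
  have h0 := hq.1
  have h1 : 0 < 1 - q := sub_pos.2 hq.2
  unfold limRatio
  refine Continuous.div (by fun_prop) (by fun_prop) fun k => ?_
  have h3 : 0 ≤ max (1 - q - k) 0 := le_max_right _ _
  positivity

lemma limRatio_zero {q : ℝ} (hq : q ∈ Ioo (0 : ℝ) 1) : limRatio 0 q = 1 := by
  have h1 : 0 < 1 - q := sub_pos.2 hq.2
  rw [limRatio, sub_zero, max_eq_left h1.le, add_sub_cancel, mul_one, div_self h1.ne']

/-- Identifies the limit with the nonnegative part of the fixed point of the recursion. -/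
lemma limRatio_natCast_div {n i : ℕ} (hi : i < n) {q : ℝ} (hq : q ∈ Ioo (0 : ℝ) 1) :
    limRatio (i / n) q = max (1 - termQuot n q i) 0 := by
  have h0 := hq.1
  have h1 : 0 < 1 - q := sub_pos.2 hq.2
  have hin : (i : ℝ) < n := by exact_mod_cast hi
  have hn : (0 : ℝ) < n := (Nat.cast_nonneg i).trans_lt hin
  have h2 : (0 : ℝ) < n - i := sub_pos.2 hin
  have h3 : 1 - termQuot n q i = (1 - q - i / n) / ((1 - q) * ((n - i) / n)) := by
    rw [termQuot]; field_simp; ring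
  have h4 : 0 < (1 - q) * ((n - i : ℝ) / n) := by positivity
  rcases le_total (1 - q - (i : ℝ) / n) 0 with h | h
  · rw [limRatio, max_eq_right h, zero_div, max_eq_right]
    rw [h3]
    exact div_nonpos_of_nonpos_of_nonneg h h4.le
  · have h5 : q + (1 - q - (i : ℝ) / n) = (n - i) / n := by field_simp; ring
    rw [limRatio, max_eq_left h, h5, max_eq_left, h3]
    rw [h3]
    positivity

lemma abs_limRatio_sub_le (k k' : ℝ) {q : ℝ} (hq : q ∈ Ioo (0 : ℝ) 1) :
    |limRatio k q - limRatio k' q| ≤ |k - k'| / ((1 - q) * q) := by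
  have h0 := hq.1
  have h1 : 0 < 1 - q := sub_pos.2 hq.2
  unfold limRatio
  have hw : |max (1 - q - k) 0 - max (1 - q - k') 0| ≤ |k - k'| := by
    refine (abs_max_sub_max_le_abs _ _ _).trans_eq ?_
    rw [abs_sub_comm k k']
    congr 1; ring
  have hw0 : 0 ≤ max (1 - q - k) 0 := le_max_right _ _
  have hw0' : 0 ≤ max (1 - q - k') 0 := le_max_right _ _
  set w := max (1 - q - k) 0
  set w' := max (1 - q - k') 0
  have h2 : w / ((1 - q) * (q + w)) - w' / ((1 - q) * (q + w'))
      = (w - w') * (q / ((1 - q) * ((q + w) * (q + w')))) := by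
    field_simp; ring
  have h3 : 0 ≤ q / ((1 - q) * ((q + w) * (q + w'))) := by positivity
  have h4 : q / ((1 - q) * ((q + w) * (q + w'))) ≤ 1 / ((1 - q) * q) := by
    rw [div_le_div_iff₀ (by positivity) (by positivity)]
    have : q * q ≤ (q + w) * (q + w') := by nlinarith [mul_nonneg hw0 hw0']
    nlinarith
  rw [h2, abs_mul, abs_of_nonneg h3, div_eq_mul_one_div |k - k'|]
  exact mul_le_mul hw h4 h3 (abs_nonneg _)

/-- The ratio at `i` lies above the fixed point at `i`, and at most `δ/2` above the nonnegative part
of the one at `i - K`, for a `K` depending only on `δ`. Shifting the index by at most `K + 1`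
changes the limit by `O(K/N)`. -/
lemma exists_abs_tailRatio_sub_limRatio_le {q : ℝ} (hq : q ∈ Ioo (0 : ℝ) 1) {δ : ℝ}
    (hδ : 0 < δ) : ∃ N₀ : ℕ, ∀ N ≥ N₀, ∀ i ≤ N,
      |tailRatio N i q - limRatio (((i : ℝ) + 1) / ((N : ℝ) + 1)) q| ≤ δ := by
  have h0 := hq.1
  have h1 : 0 < 1 - q := sub_pos.2 hq.2
  -- An excess of `δ/2` over the nonnegative part would make each of the `K` descents at least
  -- `(δ/2)²`; this choice makes their sum exceed `1`.
  obtain ⟨K, hK⟩ := exists_nat_gt (1 / (δ / 2) ^ 2)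
  rw [div_lt_iff₀ (by positivity)] at hK
  obtain ⟨N₀, hN₀⟩ := exists_nat_gt (((K : ℝ) + 1) / ((1 - q) * q) / (δ / 2))
  rw [div_lt_iff₀ (by positivity)] at hN₀
  refine ⟨N₀, fun N hN i hi => ?_⟩
  have hNN : (N₀ : ℝ) ≤ N := by exact_mod_cast hN
  have hdist : ∀ a : ℕ, a ≤ i + 1 → i ≤ a + K →
      |limRatio ((a : ℝ) / ((N + 1 : ℕ) : ℝ)) q - limRatio (((i : ℝ) + 1) / ((N : ℝ) + 1)) q|
        ≤ δ / 2 := by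
    intro a ha hia
    have ha' : (a : ℝ) ≤ i + 1 := by exact_mod_cast ha
    have hia' : (i : ℝ) ≤ a + K := by exact_mod_cast hia
    refine (abs_limRatio_sub_le _ _ hq).trans ?_
    push_cast
    rw [div_sub_div_same, abs_div, abs_of_pos (by positivity : (0 : ℝ) < N + 1), div_div,
      div_le_iff₀ (by positivity)]
    rw [div_lt_iff₀ (by positivity)] at hN₀
    have : |(a : ℝ) - (i + 1)| ≤ K + 1 := by rw [abs_le]; constructor <;> linarith
    refine this.trans (hN₀.le.trans ?_)
    have : (N₀ : ℝ) * (δ / 2 * ((1 - q) * q)) ≤ (N + 1) * (δ / 2 * ((1 - q) * q)) := by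
      gcongr; linarith
    linarith
  have hR1 := tailRatio_le_one N i (Ioo_subset_Icc_self hq)
  have hR0 := tailRatio_nonneg N i (Ioo_subset_Icc_self hq)
  have hlow := abs_le.1 (hdist i (by omega) (by omega))
  have hlow' : limRatio ((i : ℝ) / ((N + 1 : ℕ) : ℝ)) q ≤ tailRatio N i q := by
    rw [limRatio_natCast_div (by omega) hq]
    exact max_le (one_sub_termQuot_le_tailRatio hi hq) hR0
  have hup := abs_le.1 (hdist (i - K) (by omega) (by omega))
  have hup' : tailRatio N i q ≤ limRatio (((i - K : ℕ) : ℝ) / ((N + 1 : ℕ) : ℝ)) q + δ / 2 := by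
    rcases le_total K i with h | h
    · have hd := mul_tailRatio_mul_le_one (N := N) (a := i - K) (K := K) (by omega) hq
      rw [Nat.sub_add_cancel h] at hd
      rw [limRatio_natCast_div (by omega) hq]
      by_contra! hcon
      have h2 := le_max_left (1 - termQuot (N + 1) q (i - K)) 0
      have h3 := le_max_right (1 - termQuot (N + 1) q (i - K)) 0
      have h4 : (δ / 2) ^ 2
          ≤ tailRatio N i q * (tailRatio N i q - (1 - termQuot (N + 1) q (i - K))) := by
        rw [sq]
        exact mul_le_mul (by linarith) (by linarith) (by positivity) hR0
      have h5 := mul_le_mul_of_nonneg_left h4 (Nat.cast_nonneg (α := ℝ) K)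
      linarith
    -- For `i ≤ K` the truncated `i - K` is `0`, where the limit is `1` and the upper bound is
    -- trivial.
    · rw [Nat.sub_eq_zero_of_le h, Nat.cast_zero, zero_div, limRatio_zero hq]
      linarith
  rw [abs_le]
  constructor <;> linarith [hlow.1, hlow.2, hup.1, hup.2]

/-- The density of `S m n / n` with respect to the quantile function. -/
def weight (n m : ℕ) (q : ℝ) : ℝ :=
  tailRatio (n - 1) (m - 1) q * (truncMean n m q / (n * (1 - q)))

/-- The limit of `weight n m`, where `k` is the limit of `m / n`. -/
def limWeight (k q : ℝ) : ℝ := limRatio k q * (min k (1 - q) / (1 - q))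

lemma weight_nonneg (n m : ℕ) {q : ℝ} (hq : q ∈ Icc (0 : ℝ) 1) : 0 ≤ weight n m q := by
  have : 0 ≤ 1 - q := sub_nonneg.2 hq.2
  exact mul_nonneg (tailRatio_nonneg _ _ hq)
    (div_nonneg (truncMean_nonneg _ _ hq) (by positivity))

lemma weight_le_one (n m : ℕ) {q : ℝ} (hq : q ∈ Icc (0 : ℝ) 1) : weight n m q ≤ 1 := by
  have : 0 ≤ 1 - q := sub_nonneg.2 hq.2
  exact mul_le_one₀ (tailRatio_le_one _ _ hq)
    (div_nonneg (truncMean_nonneg _ _ hq) (by positivity))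
    (div_le_one_of_le₀ (truncMean_le _ _ hq) (by positivity))

lemma measurable_weight (n m : ℕ) : Measurable (weight n m) := by
  unfold weight tailRatio
  have h1 := (continuous_binomTerm (n - 1) (m - 1)).measurable
  have h2 := (continuous_binomLT (n - 1) (m - 1 + 1)).measurable
  have h3 := (continuous_truncMean n m).measurable
  fun_prop

lemma limWeight_nonneg {k : ℝ} (hk : 0 ≤ k) {q : ℝ} (hq : q ∈ Ioo (0 : ℝ) 1) :
    0 ≤ limWeight k q := by
  have : 0 < 1 - q := sub_pos.2 hq.2
  exact mul_nonneg (limRatio_nonneg _ hq) (by positivity)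

lemma limWeight_le_one {k : ℝ} (hk : 0 ≤ k) {q : ℝ} (hq : q ∈ Ioo (0 : ℝ) 1) :
    limWeight k q ≤ 1 := by
  have : 0 < 1 - q := sub_pos.2 hq.2
  exact mul_le_one₀ (limRatio_le_one hk hq) (by positivity)
    (div_le_one_of_le₀ (min_le_right _ _) this.le)

lemma measurable_limWeight (k : ℝ) : Measurable (limWeight k) := by
  unfold limWeight limRatio
  fun_prop

lemma continuous_limWeight {q : ℝ} (hq : q ∈ Ioo (0 : ℝ) 1) :
    Continuous fun k => limWeight k q := by
  have := continuous_limRatio hq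
  unfold limWeight
  fun_prop

lemma exists_abs_weight_sub_limWeight_le {q : ℝ} (hq : q ∈ Ioo (0 : ℝ) 1) {δ : ℝ}
    (hδ : 0 < δ) : ∃ N₀ : ℕ, ∀ n ≥ N₀, ∀ m : ℕ, 2 ≤ m → m ≤ n →
      |weight n m q - limWeight ((m : ℝ) / n) q| ≤ δ := by
  have h0 := hq.1
  have h1 : 0 < 1 - q := sub_pos.2 hq.2
  have hq' := Ioo_subset_Icc_self hq
  obtain ⟨N₁, hN₁⟩ := exists_abs_tailRatio_sub_limRatio_le hq (half_pos hδ)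
  obtain ⟨N₂, hN₂⟩ := exists_nat_gt ((1 / ((1 - q) * (δ / 2))) ^ 2)
  refine ⟨max (N₁ + 1) N₂, fun n hn m hm hmn => ?_⟩
  have hn1 : N₁ + 1 ≤ n := (le_max_left _ _).trans hn
  have hn2 : (N₂ : ℝ) ≤ n := by exact_mod_cast (le_max_right _ _).trans hn
  have hn0 : (0 : ℝ) < n := by exact_mod_cast (by omega : 0 < n)
  have hR := hN₁ (n - 1) (by omega) (m - 1) (by omega)
  have e1 : ((m - 1 : ℕ) : ℝ) + 1 = m := by exact_mod_cast (by omega : m - 1 + 1 = m)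
  have e2 : ((n - 1 : ℕ) : ℝ) + 1 = n := by exact_mod_cast (by omega : n - 1 + 1 = n)
  rw [e1, e2] at hR
  have hA := abs_truncMean_sub_le (m := m) (by omega : 1 ≤ n) hq'
  have hA' : |truncMean n m q / (n * (1 - q)) - min ((m : ℝ) / n) (1 - q) / (1 - q)| ≤ δ / 2 := by
    have e3 : min ((m : ℝ) / n) (1 - q) / (1 - q) = min (m : ℝ) (n * (1 - q)) / (n * (1 - q)) := by
      have : min ((m : ℝ) / n) (1 - q) = min (m : ℝ) (n * (1 - q)) / n := by
        rw [← min_div_div_right hn0.le, mul_div_cancel_left₀ _ hn0.ne']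
      rw [this, div_div]
    rw [e3, ← sub_div, abs_div, abs_of_pos (by positivity : 0 < (n : ℝ) * (1 - q)),
      div_le_iff₀ (by positivity)]
    refine hA.trans ?_
    have h5 : 1 / ((1 - q) * (δ / 2)) ≤ √n := Real.le_sqrt_of_sq_le (hN₂.le.trans hn2)
    rw [div_le_iff₀ (by positivity)] at h5
    calc √(n : ℝ) = √n * 1 := (mul_one _).symm
      _ ≤ √n * (√n * ((1 - q) * (δ / 2))) := by gcongr
      _ = δ / 2 * (n * (1 - q)) := by
        rw [← mul_assoc, Real.mul_self_sqrt hn0.le]; ring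
  have hR0 := tailRatio_nonneg (n - 1) (m - 1) hq'
  have hR1 := tailRatio_le_one (n - 1) (m - 1) hq'
  have hB0 : 0 ≤ min ((m : ℝ) / n) (1 - q) / (1 - q) := by positivity
  have hB1 : min ((m : ℝ) / n) (1 - q) / (1 - q) ≤ 1 :=
    div_le_one_of_le₀ (min_le_right _ _) h1.le
  unfold weight limWeight
  set R := tailRatio (n - 1) (m - 1) q
  set A := truncMean n m q / (n * (1 - q))
  set B := min ((m : ℝ) / n) (1 - q) / (1 - q)
  set r := limRatio ((m : ℝ) / n) q
  have e4 : R * A - r * B = R * (A - B) + (R - r) * B := by ring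
  rw [e4]
  refine (abs_add_le _ _).trans ?_
  rw [abs_mul, abs_mul, abs_of_nonneg hR0, abs_of_nonneg hB0]
  have e5 : R * |A - B| ≤ 1 * (δ / 2) := mul_le_mul hR1 hA' (abs_nonneg _) zero_le_one
  have e6 : |R - r| * B ≤ δ / 2 * 1 := mul_le_mul hR hB1 hB0 (by positivity)
  linarith

/-! ### Effort in the complete simple contest -/

namespace AbilityDistribution

variable (D : AbilityDistribution)

/-- The effort of the complete simple contest is the integral against the law of the ability `t`
times this function of `F t`. -/
def effortKernel (n m : ℕ) (q : ℝ) : ℝ :=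
  ((n - 1).choose (m - 1) : ℝ) * q ^ (n - m) * (1 - q) ^ (m - 2) / binomLT (n - 1) m q

lemma admitProb_eq_binomLT (n m : ℕ) (x : ℝ) :
    D.admitProb n m x = binomLT (n - 1) m (D.F x) := by
  rw [admitProb, binomLT, Finset.range_eq_Ico, Finset.sum_Ico_eq_sum_range]
  rw [← Finset.Ico_add_one_right_eq_Icc, Finset.sum_Ico_eq_sum_range]
  refine Finset.sum_congr (by simp) fun i _ => ?_
  have h1 : n - (1 + i) = n - 1 - i := by omega
  simp [binomTerm, h1]

/-- Only the prize gap at `l = m - 1` is nonzero. Its size `1/(m-1)` is absorbed by `(n-m+1)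
C(n-1,m-2) = (m-1) C(n-1,m-1)`. -/
lemma sum_completeSimplePrize {n m : ℕ} (hm : 2 ≤ m) (hmn : m ≤ n) (q y : ℝ) :
    ∑ l ∈ Finset.Icc 1 (m - 1), ((n - 1).choose (l - 1) : ℝ) * ((n : ℝ) - l) *
        (completeSimplePrize m l - completeSimplePrize m (l + 1)) *
        q ^ (n - l - 1) * (1 - q) ^ (l - 1) * y
      = ((n - 1).choose (m - 1) : ℝ) * q ^ (n - m) * (1 - q) ^ (m - 2) * y := by
  obtain ⟨k, rfl⟩ : ∃ k, m = k + 2 := ⟨m - 2, by omega⟩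
  obtain ⟨d, rfl⟩ : ∃ d, n = k + 2 + d := ⟨n - (k + 2), by omega⟩
  rw [Finset.sum_eq_single (k + 1)]
  · have e1 : k + 2 + d - 1 = k + 1 + d := by omega
    have e2 : k + 2 + d - (k + 1) - 1 = d := by omega
    have e3 : k + 2 + d - (k + 2) = d := by omega
    have h3 : ((k + 1 + d).choose (k + 1) : ℝ) * (k + 1) = (k + 1 + d).choose k * (d + 1) := by
      have := Nat.choose_succ_right_eq (k + 1 + d) k
      have e4 : k + 1 + d - k = d + 1 := by omega
      rw [e4] at this
      exact_mod_cast this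
    have h4 : completeSimplePrize (k + 2) (k + 1) - completeSimplePrize (k + 2) (k + 1 + 1)
        = 1 / ((k : ℝ) + 1) := by
      rw [completeSimplePrize, completeSimplePrize, if_pos (by omega), if_neg (by omega)]
      push_cast
      ring
    rw [h4, e1, e2, e3]
    simp only [Nat.add_sub_cancel, show k + 2 - 1 = k + 1 by omega]
    have : (k : ℝ) + 1 ≠ 0 := by positivity
    push_cast
    field_simp
    linear_combination (-(q ^ d * (1 - q) ^ k * y)) * h3
  · intro l hl hne
    rw [Finset.mem_Icc] at hl
    rw [completeSimplePrize, completeSimplePrize, if_pos (by omega), if_pos (by omega)]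
    ring
  · intro h
    exact absurd (Finset.mem_Icc.2 ⟨by omega, by omega⟩) h

lemma effort_eq_intervalIntegral {n m : ℕ} (hm : 2 ≤ m) (hmn : m ≤ n) (x : ℝ) :
    D.effort n m (completeSimplePrize m) x
      = ∫ t in (0 : ℝ)..x, t * effortKernel n m (D.F t) * D.f t := by
  rw [effort]
  refine intervalIntegral.integral_congr fun t _ => ?_
  rw [sum_completeSimplePrize hm hmn, admitProb_eq_binomLT, effortKernel]
  ring

lemma measurable_effortKernel (n m : ℕ) : Measurable (effortKernel n m) := by
  have := (continuous_binomLT (n - 1) m).measurable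
  unfold effortKernel
  fun_prop

lemma effortKernel_nonneg (n m : ℕ) {q : ℝ} (hq : q ∈ Icc (0 : ℝ) 1) :
    0 ≤ effortKernel n m q := by
  have h0 := hq.1
  have h1 : 0 ≤ 1 - q := sub_nonneg.2 hq.2
  exact div_nonneg (by positivity) (binomLT_nonneg _ _ hq)

/-- For `q ≤ 1/2`, the kernel times `1 - q` is a tail ratio, hence at most `1`. For `q ≥ 1/2` the
denominator is at least its zeroth term `q^(n-1) ≥ 2^(-(n-1))`. The bound may depend on `n` and `m`:
it serves only integrability. -/
lemma exists_effortKernel_le {n m : ℕ} (hm : 2 ≤ m) (hmn : m ≤ n) :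
    ∃ C, 0 ≤ C ∧ ∀ q ∈ Icc (0 : ℝ) 1, effortKernel n m q ≤ C := by
  refine ⟨max 2 (((n - 1).choose (m - 1) : ℝ) * 2 ^ (n - 1)), by positivity, fun q hq => ?_⟩
  have h0 := hq.1
  have h1 : 0 ≤ 1 - q := sub_nonneg.2 hq.2
  have hJ := binomLT_nonneg (n - 1) m hq
  have hterm : ∀ i < m, binomTerm (n - 1) i q ≤ binomLT (n - 1) m q := fun i hi =>
    Finset.single_le_sum (f := fun i => binomTerm (n - 1) i q)
      (fun i _ => binomTerm_nonneg _ i hq) (Finset.mem_range.2 hi)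
  rcases le_total q (1 / 2) with h | h
  · refine le_max_of_le_left (div_le_of_le_mul₀ hJ zero_le_two ?_)
    have h2 := hterm (m - 1) (by omega)
    have e1 : n - 1 - (m - 1) = n - m := by omega
    have e2 : m - 1 = m - 2 + 1 := by omega
    rw [binomTerm, e1] at h2
    rw [show (1 - q) ^ (m - 1) = (1 - q) ^ (m - 2) * (1 - q) by rw [e2, pow_succ]] at h2
    have h3 : 0 ≤ ((n - 1).choose (m - 1) : ℝ) * q ^ (n - m) * (1 - q) ^ (m - 2) := by positivity
    nlinarith
  · refine le_max_of_le_right (div_le_of_le_mul₀ hJ (by positivity) ?_)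
    have h2 := hterm 0 (by omega)
    have h3 : (1 / 2 : ℝ) ^ (n - 1) ≤ q ^ (n - 1) := by gcongr
    simp only [binomTerm, Nat.choose_zero_right, Nat.cast_one, one_mul, Nat.sub_zero, pow_zero,
      mul_one] at h2
    have h4 : q ^ (n - m) ≤ 1 := pow_le_one₀ h0 hq.2
    have h5 : (1 - q) ^ (m - 2) ≤ 1 := pow_le_one₀ h1 (by linarith)
    have h6 : (1 : ℝ) ≤ 2 ^ (n - 1) * binomLT (n - 1) m q := by
      have : (2 : ℝ) ^ (n - 1) * (1 / 2) ^ (n - 1) = 1 := by rw [← mul_pow]; norm_num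
      rw [← this]
      gcongr
      exact h3.trans h2
    have h7 : q ^ (n - m) * (1 - q) ^ (m - 2) ≤ 1 := mul_le_one₀ h4 (by positivity) h5
    rw [mul_assoc, mul_assoc]
    exact mul_le_mul_of_nonneg_left (h7.trans h6) (Nat.cast_nonneg _)

lemma effortKernel_mul {n m : ℕ} (hm : 2 ≤ m) (hmn : m ≤ n) (q : ℝ) :
    effortKernel n m q * (1 - q) = tailRatio (n - 1) (m - 1) q := by
  have e1 : n - 1 - (m - 1) = n - m := by omega
  have e2 : m - 2 + 1 = m - 1 := by omega
  have e3 : m - 1 + 1 = m := by omega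
  rw [effortKernel, tailRatio, binomTerm, e1, e3, ← e2, pow_succ]
  ring

lemma F_mem_Icc (x : ℝ) : D.F x ∈ Icc (0 : ℝ) 1 := ⟨D.F_nonneg x, D.F_le_one x⟩

lemma measurable_F : Measurable D.F := D.continuous_F.measurable

lemma integrable_effort_integrand {n m : ℕ} (hm : 2 ≤ m) (hmn : m ≤ n) :
    Integrable fun t => t * effortKernel n m (D.F t) * D.f t := by
  obtain ⟨C, -, hC⟩ := exists_effortKernel_le hm hmn
  have := D.integrable_mean.bdd_mul (c := C)
    ((measurable_effortKernel n m).comp D.measurable_F).aestronglyMeasurable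
    (Eventually.of_forall fun t => by
      rw [Function.comp_apply, Real.norm_of_nonneg (effortKernel_nonneg n m (D.F_mem_Icc t))]
      exact hC _ (D.F_mem_Icc t))
  refine this.congr (Eventually.of_forall fun t => ?_)
  simp only [Function.comp_apply]
  ring

lemma continuous_effort {n m : ℕ} (hm : 2 ≤ m) (hmn : m ≤ n) :
    Continuous (D.effort n m (completeSimplePrize m)) := by
  have : D.effort n m (completeSimplePrize m)
      = fun x => ∫ t in (0 : ℝ)..x, t * effortKernel n m (D.F t) * D.f t :=
    funext (D.effort_eq_intervalIntegral hm hmn)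
  rw [this]
  exact intervalIntegral.continuous_primitive
    (fun a b => (D.integrable_effort_integrand hm hmn).intervalIntegrable) 0

lemma exists_abs_effort_le {n m : ℕ} (hm : 2 ≤ m) (hmn : m ≤ n) :
    ∃ C, 0 ≤ C ∧ ∀ x, |D.effort n m (completeSimplePrize m) x| ≤ C := by
  refine ⟨∫ t, ‖t * effortKernel n m (D.F t) * D.f t‖, by positivity, fun x => ?_⟩
  rw [effort_eq_intervalIntegral D hm hmn, ← Real.norm_eq_abs]
  refine intervalIntegral.norm_integral_le_integral_norm_uIoc.trans ?_
  exact setIntegral_le_integral (D.integrable_effort_integrand hm hmn).norm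
    (Eventually.of_forall fun t => norm_nonneg _)

lemma effort_Finv {n m : ℕ} (hm : 2 ≤ m) (hmn : m ≤ n) {p : ℝ} (hp : p ∈ Ioo (0 : ℝ) 1) :
    D.effort n m (completeSimplePrize m) (D.Finv p)
      = ∫ q in Ioo (0 : ℝ) 1, (Iic p).indicator (fun q => D.Finv q * effortKernel n m q) q := by
  rw [D.effort_eq_intervalIntegral hm hmn, intervalIntegral.integral_of_le (D.Finv_pos hp).le,
    ← D.setIntegral_law_eq measurableSet_Ioc, ← integral_indicator measurableSet_Ioc,
    D.integral_law_eq_integral_Finv]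
  · refine setIntegral_congr_fun measurableSet_Ioo fun q hq => ?_
    by_cases h : q ≤ p
    · rw [indicator_of_mem (show q ∈ Iic p from h), indicator_of_mem
        (show D.Finv q ∈ Ioc 0 (D.Finv p) from
          ⟨D.Finv_pos hq, (D.Finv_le_iff hq _).2 (by rwa [D.F_Finv hp])⟩), D.F_Finv hq]
    · rw [indicator_of_notMem (show q ∉ Iic p from h), indicator_of_notMem]
      rintro ⟨-, h2⟩
      rw [D.Finv_le_iff hq, D.F_Finv hp] at h2
      exact h h2
  · exact (measurable_id.mul ((measurable_effortKernel n m).comp D.measurable_F)).indicator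
      measurableSet_Ioc

/-! ### Admission probability and the quantile formula for total effort -/

lemma measurable_card_filter_lt {ι : Type*} [Fintype ι] :
    Measurable fun z : ℝ × (ι → ℝ) => (Finset.univ.filter fun j => z.1 < z.2 j).card := by
  simp only [Finset.card_filter]
  refine Finset.measurable_sum _ fun j _ => Measurable.ite ?_ measurable_const measurable_const
  exact measurableSet_lt measurable_fst ((measurable_pi_apply j).comp measurable_snd)

lemma real_law_Ioi (a : ℝ) : D.law.real (Ioi a) = 1 - D.F a := by
  rw [F_eq_real, ← compl_Iic, probReal_compl_eq_one_sub measurableSet_Iic]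

/-- The event splits into disjoint boxes `B s`, indexed by the set `s` of coordinates exceeding `a`.
The measure of a box depends only on the cardinality of `s`, which produces the binomial
coefficients. -/
lemma pi_law_real_card_lt {N m : ℕ} (hm : m ≤ N + 1) (a : ℝ) :
    (Measure.pi fun _ : Fin N => D.law).real
      {y | (Finset.univ.filter fun j => a < y j).card < m} = binomLT N m (D.F a) := by
  classical
  let B : Finset (Fin N) → Set (Fin N → ℝ) := fun s =>
    Set.univ.pi fun j => if j ∈ s then Ioi a else Iic a
  have hBmem : ∀ s y, y ∈ B s ↔ (Finset.univ.filter fun j => a < y j) = s := by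
    intro s y
    simp only [B, Set.mem_univ_pi, Finset.ext_iff, Finset.mem_filter, Finset.mem_univ, true_and]
    refine forall_congr' fun j => ?_
    by_cases h : j ∈ s <;> simp [h]
  have hset : {y : Fin N → ℝ | (Finset.univ.filter fun j => a < y j).card < m}
      = ⋃ s ∈ Finset.univ.filter (fun s : Finset (Fin N) => s.card < m), B s := by
    ext y
    simp only [mem_ofPred_eq, Finset.mem_filter, Finset.mem_univ, true_and, mem_iUnion,
      exists_prop, hBmem]
    simp
  have hmeas : ∀ s, MeasurableSet (B s) := fun s =>
    MeasurableSet.univ_pi fun j => by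
      by_cases h : j ∈ s
      · simp only [h, if_true]; exact measurableSet_Ioi
      · simp only [h, if_false]; exact measurableSet_Iic
  have hreal : ∀ s, (Measure.pi fun _ : Fin N => D.law).real (B s)
      = D.F a ^ (N - s.card) * (1 - D.F a) ^ s.card := by
    intro s
    rw [measureReal_def, Measure.pi_pi, ENNReal.toReal_prod]
    have : ∀ j, (D.law (if j ∈ s then Ioi a else Iic a)).toReal
        = if j ∈ s then 1 - D.F a else D.F a := by
      intro j
      by_cases h : j ∈ s
      · simp only [h, if_true]; exact D.real_law_Ioi a
      · simp only [h, if_false]; exact (D.F_eq_real a).symm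
    simp only [this]
    rw [Finset.prod_ite]
    simp only [Finset.prod_const]
    rw [mul_comm]
    congr 2
    · rw [Finset.filter_not, Finset.card_sdiff_of_subset (Finset.filter_subset _ _)]
      simp
    · simp
  rw [hset, measureReal_biUnion_finset]
  · simp only [hreal]
    rw [Finset.sum_filter]
    have h := Finset.sum_powerset_apply_card
      (fun i => if i < m then D.F a ^ (N - i) * (1 - D.F a) ^ i else 0)
      (x := (Finset.univ : Finset (Fin N)))
    rw [Finset.powerset_univ] at h
    rw [h, Finset.card_univ, Fintype.card_fin, binomLT,
      ← Finset.sum_subset (Finset.range_mono hm)]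
    · refine Finset.sum_congr rfl fun i hi => ?_
      rw [if_pos (Finset.mem_range.1 hi), nsmul_eq_mul, binomTerm, mul_assoc]
    · intro i _ hi
      rw [if_neg fun h => hi (Finset.mem_range.2 h), smul_zero]
  · intro s _ t _ hst
    refine Set.disjoint_left.2 fun y hs ht => hst ?_
    rw [← (hBmem s y).1 hs, (hBmem t y).1 ht]
  · exact fun s _ => hmeas s

lemma integral_pi_admitted {N m : ℕ} (hm : m ≤ N + 1) {b : ℝ → ℝ} (hb : Measurable b) {C : ℝ}
    (hC : ∀ x, |b x| ≤ C) (i : Fin (N + 1)) :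
    Integrable (fun x : Fin (N + 1) → ℝ =>
      if (Finset.univ.filter (fun j => x i < x j)).card < m then b (x i) else 0)
      (Measure.pi fun _ => D.law) ∧
    ∫ x : Fin (N + 1) → ℝ,
      (if (Finset.univ.filter (fun j => x i < x j)).card < m then b (x i) else 0)
      ∂(Measure.pi fun _ => D.law)
      = ∫ x, b x * binomLT N m (D.F x) ∂D.law := by
  set G : ℝ × (Fin N → ℝ) → ℝ := fun z =>
    if (Finset.univ.filter (fun j => z.1 < z.2 j)).card < m then b z.1 else 0 with hG
  have hGm : Measurable G :=
    Measurable.ite (measurable_card_filter_lt measurableSet_Iio) (hb.comp measurable_fst)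
      measurable_const
  have hGi : Integrable G (D.law.prod (Measure.pi fun _ => D.law)) := by
    refine Integrable.of_bound hGm.aestronglyMeasurable C (Eventually.of_forall fun z => ?_)
    simp only [hG]
    split_ifs
    · exact hC _
    · simpa using (abs_nonneg _).trans (hC 0)
  have hmp := measurePreserving_piFinSuccAbove (fun _ : Fin (N + 1) => D.law) i
  have hcomp : (fun x : Fin (N + 1) → ℝ =>
      if (Finset.univ.filter (fun j => x i < x j)).card < m then b (x i) else 0)
      = G ∘ MeasurableEquiv.piFinSuccAbove (fun _ => ℝ) i := by
    funext x
    -- Nobody is strictly abler than himself, so the count involves only the other `N` coordinates,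
    -- independent of `x i`.
    have : (Finset.univ.filter (fun j => x i < x j)).card
        = (Finset.univ.filter (fun j : Fin N => x i < x (i.succAbove j))).card := by
      rw [Finset.card_filter, Finset.card_filter, Fin.sum_univ_succAbove _ i]
      simp
    simp only [hG, Function.comp_apply, this]
    rfl
  rw [hcomp]
  refine ⟨(hmp.integrable_comp_emb (MeasurableEquiv.measurableEmbedding _)).2 hGi, ?_⟩
  have h1 := hmp.integral_comp' G
  rw [show ∫ x, (G ∘ MeasurableEquiv.piFinSuccAbove (fun _ => ℝ) i) x
    ∂(Measure.pi fun _ => D.law) = _ from h1, integral_prod _ hGi]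
  refine integral_congr_ae (Eventually.of_forall fun a => ?_)
  have hA : MeasurableSet {y : Fin N → ℝ | (Finset.univ.filter fun j => a < y j).card < m} :=
    (measurable_card_filter_lt.comp measurable_prodMk_left) measurableSet_Iio
  have h2 : (fun y => G (a, y)) = {y : Fin N → ℝ |
      (Finset.univ.filter fun j => a < y j).card < m}.indicator fun _ => b a := by
    funext y
    simp only [hG, indicator, mem_ofPred_eq]
  simp only [h2]
  rw [integral_indicator_const _ hA, D.pi_law_real_card_lt hm, smul_eq_mul, mul_comm]

lemma S_eq_integral_law {n m : ℕ} (hm : 2 ≤ m) (hmn : m ≤ n) :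
    D.S m n = n * ∫ x, D.effort n m (completeSimplePrize m) x * binomLT (n - 1) m (D.F x)
      ∂D.law := by
  obtain ⟨N, rfl⟩ : ∃ N, n = N + 1 := ⟨n - 1, by omega⟩
  obtain ⟨C, -, hC⟩ := D.exists_abs_effort_le hm hmn
  have h := D.integral_pi_admitted hmn (D.continuous_effort hm hmn).measurable hC
  rw [S, totalEffort, integral_finsetSum _ fun i _ => (h i).1]
  simp only [(h _).2]
  simp

/-- Fubini on `q ≤ p`: the inner integral of the admission probability over `p ∈ [q,1)` is the
truncated mean divided by `n`, and the kernel supplies the tail ratio divided by `1 - q`. -/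
lemma S_div_eq {n m : ℕ} (hm : 2 ≤ m) (hmn : m ≤ n) :
    D.S m n / n = ∫ q in Ioo (0 : ℝ) 1, D.Finv q * weight n m q := by
  have hn : (0 : ℝ) < n := by exact_mod_cast (by omega : 0 < n)
  obtain ⟨C, hC0, hC⟩ := exists_effortKernel_le hm hmn
  rw [D.S_eq_integral_law hm hmn, mul_div_cancel_left₀ _ hn.ne',
    D.integral_law_eq_integral_Finv
      (G := fun x => D.effort n m (completeSimplePrize m) x * binomLT (n - 1) m (D.F x))
      ((D.continuous_effort hm hmn).mul
      ((continuous_binomLT _ _).comp D.continuous_F)).measurable]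
  set ν := volume.restrict (Ioo (0 : ℝ) 1) with hν
  set H : ℝ → ℝ → ℝ := fun p q => binomLT (n - 1) m p *
    (Iic p).indicator (fun q => D.Finv q * effortKernel n m q) q with hH
  have h1 : ∫ p, D.effort n m (completeSimplePrize m) (D.Finv p)
      * binomLT (n - 1) m (D.F (D.Finv p)) ∂ν = ∫ p, ∫ q, H p q ∂ν ∂ν := by
    refine setIntegral_congr_fun measurableSet_Ioo fun p hp => ?_
    simp only [hH]
    rw [integral_const_mul, D.effort_Finv hm hmn hp, D.F_Finv hp, mul_comm]
  have hind : ∀ p q, (Iic p).indicator (fun q => D.Finv q * effortKernel n m q) q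
      = D.Finv q * ({z : ℝ × ℝ | z.2 ≤ z.1}.indicator (fun z => effortKernel n m z.2) (p, q)) := by
    intro p q
    by_cases h : q ≤ p <;> simp [indicator, h]
  have hint : Integrable (Function.uncurry H) (ν.prod ν) := by
    have hF : Integrable (fun z : ℝ × ℝ => C * D.Finv z.2) (ν.prod ν) :=
      (D.integrableOn_Finv.comp_snd ν).const_mul C
    refine hF.mono' ?_ ?_
    · have : Function.uncurry H = fun z => binomLT (n - 1) m z.1 *
          (D.Finv z.2 * ({z : ℝ × ℝ | z.2 ≤ z.1}.indicator (fun z => effortKernel n m z.2) z)) := by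
        funext z
        simp only [Function.uncurry, hH, hind]
      rw [this]
      refine ((continuous_binomLT _ _).measurable.comp measurable_fst).aestronglyMeasurable.mul
        (D.integrableOn_Finv.aestronglyMeasurable.comp_snd.mul ?_)
      exact (((measurable_effortKernel n m).comp measurable_snd).indicator
        (measurableSet_le measurable_snd measurable_fst)).aestronglyMeasurable
    · have hae : ∀ᵐ z ∂(ν.prod ν), z ∈ Ioo (0 : ℝ) 1 ×ˢ Ioo (0 : ℝ) 1 := by
        rw [hν, Measure.prod_restrict]
        exact ae_restrict_mem (measurableSet_Ioo.prod measurableSet_Ioo)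
      filter_upwards [hae] with z hz
      have hz1 := Ioo_subset_Icc_self hz.1
      have hz2 := Ioo_subset_Icc_self hz.2
      have hFp := (D.Finv_pos hz.2).le
      have hK := hC _ hz2
      have hK0 := effortKernel_nonneg n m hz2
      have hJ0 := binomLT_nonneg (n - 1) m hz1
      have hJ1 := binomLT_le_one (N := n - 1) (m := m) (by omega) hz1
      simp only [Function.uncurry, hH]
      rw [norm_mul, Real.norm_of_nonneg hJ0]
      refine (mul_le_of_le_one_left (norm_nonneg _) hJ1).trans ?_
      refine (norm_indicator_le_norm_self _ _).trans ?_
      rw [Real.norm_of_nonneg (mul_nonneg hFp hK0), mul_comm C]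
      exact mul_le_mul_of_nonneg_left hK hFp
  rw [h1, integral_integral_swap hint]
  refine setIntegral_congr_fun measurableSet_Ioo fun q hq => ?_
  have h1q : 0 < 1 - q := sub_pos.2 hq.2
  have h2 : ∀ p, H p q = (Ici q).indicator (binomLT (n - 1) m) p
      * (D.Finv q * effortKernel n m q) := by
    intro p
    by_cases h : q ≤ p <;> simp [hH, indicator, h]
  have h3 : ∫ p, (Ici q).indicator (binomLT (n - 1) m) p ∂ν = truncMean n m q / n := by
    obtain ⟨N, rfl⟩ : ∃ N, n = N + 1 := ⟨n - 1, by omega⟩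
    have h4 := integral_binomLT (N := N) hmn q
    rw [intervalIntegral.integral_of_le hq.2.le, integral_Ioc_eq_integral_Ioo,
      ← integral_Ico_eq_integral_Ioo] at h4
    rw [integral_indicator measurableSet_Ici, hν, Measure.restrict_restrict measurableSet_Ici]
    have h5 : Ici q ∩ Ioo 0 1 = Ico q 1 := by
      ext x
      exact ⟨fun h => ⟨h.1, h.2.2⟩, fun h => ⟨h.1, hq.1.trans_le h.1, h.2⟩⟩
    rw [h5, Nat.add_sub_cancel, h4]
    push_cast
    rfl
  simp only [h2]
  rw [integral_mul_const, h3, weight, ← effortKernel_mul hm hmn q]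
  field_simp

/-! ### The limit function and its interior maximum -/

/-- The limit function `phi`, written as an integral over `(0, 1)`. -/
def phiExt (k : ℝ) : ℝ := ∫ q in Ioo (0 : ℝ) 1, D.Finv q * limWeight k q

lemma limWeight_of_lt {k q : ℝ} (hk : k ∈ Ioc (0 : ℝ) 1) (hq : 0 < q) (hqk : q < 1 - k) :
    limWeight k q = k / (1 - k) * ((1 - q - k) / (1 - q) ^ 2) := by
  have h1 : 1 - q ≠ 0 := by linarith [hk.1]
  have h2 : 1 - k ≠ 0 := by linarith
  have h3 : q + (1 - q - k) = 1 - k := by ring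
  rw [limWeight, limRatio, max_eq_left (by linarith), min_eq_left (by linarith), h3]
  field_simp

lemma limWeight_of_le {k q : ℝ} (hqk : 1 - k ≤ q) : limWeight k q = 0 := by
  rw [limWeight, limRatio, max_eq_right (by linarith), zero_div, zero_mul]

lemma setIntegral_indicator_Iio {k : ℝ} (hk : k ∈ Ioc (0 : ℝ) 1) (g : ℝ → ℝ) :
    ∫ q in Ioo (0 : ℝ) 1, (Iio (1 - k)).indicator g q = ∫ q in (0 : ℝ)..(1 - k), g q := by
  rw [intervalIntegral.integral_of_le (by linarith [hk.2]), integral_Ioc_eq_integral_Ioo,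
    integral_indicator measurableSet_Iio, Measure.restrict_restrict measurableSet_Iio]
  congr 2
  ext x
  exact ⟨fun h => ⟨h.2.1, h.1⟩, fun h => ⟨h.2, h.1, h.2.trans (by linarith [hk.1])⟩⟩

lemma phi_eq_phiExt {k : ℝ} (hk : k ∈ Ioc (0 : ℝ) 1) : D.phi k = D.phiExt k := by
  rw [phi, ← setIntegral_indicator_Iio hk, phiExt]
  refine setIntegral_congr_fun measurableSet_Ioo fun q hq => ?_
  by_cases h : q < 1 - k
  · rw [indicator_of_mem (show q ∈ Iio (1 - k) from h), limWeight_of_lt hk hq.1 h]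
    have h0 := hq.1.ne'
    have h1 : 1 - q ≠ 0 := by linarith [hk.1]
    have h2 : 1 - k ≠ 0 := by linarith [hq.1]
    field_simp
  · rw [indicator_of_notMem (show q ∉ Iio (1 - k) from h), limWeight_of_le (not_lt.1 h), mul_zero]

lemma norm_Finv_mul_le {q : ℝ} (hq : q ∈ Ioo (0 : ℝ) 1) {w : ℝ} (hw : |w| ≤ 1) :
    ‖D.Finv q * w‖ ≤ D.Finv q := by
  rw [norm_mul, Real.norm_of_nonneg (D.Finv_pos hq).le]
  exact mul_le_of_le_one_right (D.Finv_pos hq).le hw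

lemma aestronglyMeasurable_Finv_mul {w : ℝ → ℝ} (hw : Measurable w) :
    AEStronglyMeasurable (fun q => D.Finv q * w q) (volume.restrict (Ioo 0 1)) :=
  D.integrableOn_Finv.aestronglyMeasurable.mul hw.aestronglyMeasurable

lemma integrableOn_Finv_mul {w : ℝ → ℝ} (hw : Measurable w)
    (hb : ∀ q ∈ Ioo (0 : ℝ) 1, |w q| ≤ 1) : IntegrableOn (fun q => D.Finv q * w q) (Ioo 0 1) := by
  refine D.integrableOn_Finv.mono' (D.aestronglyMeasurable_Finv_mul hw) ?_
  filter_upwards [ae_restrict_mem measurableSet_Ioo] with q hq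
  exact D.norm_Finv_mul_le hq (hb q hq)

lemma abs_limWeight_le {k : ℝ} (hk : 0 ≤ k) {q : ℝ} (hq : q ∈ Ioo (0 : ℝ) 1) :
    |limWeight k q| ≤ 1 := by
  rw [abs_of_nonneg (limWeight_nonneg hk hq)]
  exact limWeight_le_one hk hq

lemma abs_weight_le (n m : ℕ) {q : ℝ} (hq : q ∈ Ioo (0 : ℝ) 1) : |weight n m q| ≤ 1 := by
  rw [abs_of_nonneg (weight_nonneg n m (Ioo_subset_Icc_self hq))]
  exact weight_le_one n m (Ioo_subset_Icc_self hq)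

lemma continuousOn_phiExt : ContinuousOn D.phiExt (Icc 0 1) := by
  refine continuousOn_of_dominated (bound := D.Finv)
    (fun k _ => D.aestronglyMeasurable_Finv_mul (measurable_limWeight k)) ?_
    D.integrableOn_Finv ?_
  · intro k hk
    filter_upwards [ae_restrict_mem measurableSet_Ioo] with q hq
    exact D.norm_Finv_mul_le hq (abs_limWeight_le hk.1 hq)
  · filter_upwards [ae_restrict_mem measurableSet_Ioo] with q hq
    exact (continuous_const.mul (continuous_limWeight hq)).continuousOn

lemma phiExt_zero : D.phiExt 0 = 0 := by
  rw [phiExt, setIntegral_congr_fun (g := fun _ => 0) measurableSet_Ioo]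
  · simp
  · intro q hq
    simp [limWeight, min_eq_left (sub_pos.2 hq.2).le]

lemma phiExt_one : D.phiExt 1 = 0 := by
  rw [← D.phi_eq_phiExt ⟨zero_lt_one, le_rfl⟩, phi, sub_self, intervalIntegral.integral_same]

lemma phiExt_half_pos : 0 < D.phiExt (1 / 2) := by
  have hk : (1 / 2 : ℝ) ∈ Ioc (0 : ℝ) 1 := by norm_num
  rw [phiExt, setIntegral_pos_iff_support_of_nonneg_ae]
  · have : Ioo (0 : ℝ) (1 / 2)
        ⊆ Function.support (fun q => D.Finv q * limWeight (1 / 2) q) ∩ Ioo 0 1 := by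
      intro q hq
      have hq1 : q ∈ Ioo (0 : ℝ) 1 := ⟨hq.1, hq.2.trans (by norm_num)⟩
      refine ⟨?_, hq1⟩
      rw [Function.mem_support, limWeight_of_lt hk hq.1 (by linarith [hq.2])]
      have h1 : 0 < 1 - q := sub_pos.2 hq1.2
      have h2 : 0 < 1 - q - 1 / 2 := by linarith [hq.2]
      have h3 := D.Finv_pos hq1
      have h4 : (0 : ℝ) < 1 - 1 / 2 := by norm_num
      positivity
    refine lt_of_lt_of_le ?_ (measure_mono this)
    rw [Real.volume_Ioo]
    norm_num
  · filter_upwards [ae_restrict_mem measurableSet_Ioo] with q hq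
    exact mul_nonneg (D.Finv_pos hq).le (limWeight_nonneg (by norm_num) hq)
  · exact D.integrableOn_Finv_mul (measurable_limWeight _)
      fun q hq => abs_limWeight_le (by norm_num) hq

/-- A continuous function on a compact interval, zero at both ends and positive in the middle. -/
lemma exists_isMaxOn_phiExt : ∃ k ∈ Ioo (0 : ℝ) 1, IsMaxOn D.phiExt (Icc 0 1) k := by
  obtain ⟨k, hk, hmax⟩ := isCompact_Icc.exists_isMaxOn (nonempty_Icc.2 zero_le_one)
    D.continuousOn_phiExt
  have h1 : 0 < D.phiExt k :=
    D.phiExt_half_pos.trans_le (hmax (show (1 / 2 : ℝ) ∈ Icc (0 : ℝ) 1 by norm_num))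
  refine ⟨k, ⟨lt_of_le_of_ne hk.1 ?_, lt_of_le_of_ne hk.2 ?_⟩, hmax⟩
  · rintro rfl
    exact h1.ne' D.phiExt_zero
  · rintro rfl
    exact h1.ne' D.phiExt_one

lemma isMaxOn_phi_of_isMaxOn_phiExt {k : ℝ} (hk : k ∈ Ioo (0 : ℝ) 1)
    (h : IsMaxOn D.phiExt (Icc 0 1) k) : IsMaxOn D.phi (Ioo 0 1) k := by
  intro x hx
  rw [mem_ofPred_eq, D.phi_eq_phiExt (Ioo_subset_Ioc_self hx),
    D.phi_eq_phiExt (Ioo_subset_Ioc_self hk)]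
  exact h (Ioo_subset_Icc_self hx)

/-! ### Uniform convergence -/

/-- `S m n / n` is uniformly close to the limit function. -/
lemma exists_abs_S_div_sub_phiExt_le {ε : ℝ} (hε : 0 < ε) : ∃ N : ℕ, ∀ n : ℕ, N ≤ n → ∀ m : ℕ,
    2 ≤ m → m ≤ n → |D.S m n / n - D.phiExt ((m : ℝ) / n)| ≤ ε := by
  -- Convergence along this filter is convergence as `n → ∞` uniformly in admissible `m`, so a
  -- single application of dominated convergence gives the uniform statement.
  set l : Filter (ℕ × ℕ) := comap Prod.fst atTop ⊓ 𝓟 {z | 2 ≤ z.2 ∧ z.2 ≤ z.1} with hl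
  have hmem : ∀ {P : ℕ × ℕ → Prop}, (∀ᶠ z in l, P z) ↔
      ∃ N : ℕ, ∀ n : ℕ, N ≤ n → ∀ m : ℕ, 2 ≤ m → m ≤ n → P (n, m) := by
    intro P
    rw [hl, eventually_inf_principal, eventually_comap, eventually_atTop]
    constructor
    · rintro ⟨N, hN⟩
      exact ⟨N, fun n hn m h1 h2 => hN n hn (n, m) rfl ⟨h1, h2⟩⟩
    · rintro ⟨N, hN⟩
      refine ⟨N, fun n hn z hz h => ?_⟩
      subst hz
      exact hN z.1 hn z.2 h.1 h.2
  have hlim : Tendsto (fun z : ℕ × ℕ => ∫ q in Ioo (0 : ℝ) 1,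
      D.Finv q * (weight z.1 z.2 q - limWeight ((z.2 : ℝ) / z.1) q)) l (𝓝 (∫ _ in Ioo (0 : ℝ) 1,
        (0 : ℝ))) := by
    refine tendsto_integral_filter_of_dominated_convergence D.Finv ?_ ?_ D.integrableOn_Finv ?_
    · exact Eventually.of_forall fun z => D.aestronglyMeasurable_Finv_mul
        ((measurable_weight _ _).sub (measurable_limWeight _))
    · refine Eventually.of_forall fun z => ?_
      filter_upwards [ae_restrict_mem measurableSet_Ioo] with q hq
      refine D.norm_Finv_mul_le hq ?_
      have h1 := weight_nonneg z.1 z.2 (Ioo_subset_Icc_self hq)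
      have h2 := weight_le_one z.1 z.2 (Ioo_subset_Icc_self hq)
      have hk : (0 : ℝ) ≤ (z.2 : ℝ) / z.1 := by positivity
      have h3 := limWeight_nonneg hk hq
      have h4 := limWeight_le_one hk hq
      rw [abs_le]
      constructor <;> linarith
    · filter_upwards [ae_restrict_mem measurableSet_Ioo] with q hq
      rw [← mul_zero (D.Finv q)]
      refine Tendsto.const_mul _ (Metric.tendsto_nhds.2 fun δ hδ => hmem.2 ?_)
      obtain ⟨N, hN⟩ := exists_abs_weight_sub_limWeight_le hq (half_pos hδ)
      refine ⟨N, fun n hn m h1 h2 => ?_⟩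
      rw [Real.dist_eq, sub_zero]
      exact (hN n hn m h1 h2).trans_lt (half_lt_self hδ)
  rw [integral_zero] at hlim
  obtain ⟨N, hN⟩ := hmem.1 (Metric.tendsto_nhds.1 hlim ε hε)
  refine ⟨N, fun n hn m h1 h2 => ?_⟩
  have h := hN n hn m h1 h2
  rw [Real.dist_eq, sub_zero] at h
  simp only [mul_sub] at h
  rw [integral_sub] at h
  · rw [D.S_div_eq h1 h2, phiExt]
    exact h.le
  · exact D.integrableOn_Finv_mul (measurable_weight _ _) fun q hq => abs_weight_le _ _ hq
  · exact D.integrableOn_Finv_mul (measurable_limWeight _)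
      fun q hq => abs_limWeight_le (by positivity) hq

/-! ### First-order equation -/

/-- The integral factor of the limit function. -/
def phiFactor (k : ℝ) : ℝ :=
  ∫ q in Ioo (0 : ℝ) 1, D.Finv q * (max (1 - q - k) 0 / (1 - q) ^ 2)

lemma phi_eq_mul_phiFactor {k : ℝ} (hk : k ∈ Ioo (0 : ℝ) 1) :
    D.phi k = k / (1 - k) * D.phiFactor k := by
  rw [D.phi_eq_phiExt (Ioo_subset_Ioc_self hk), phiExt, phiFactor, ← integral_const_mul]
  refine setIntegral_congr_fun measurableSet_Ioo fun q hq => ?_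
  rcases lt_or_ge q (1 - k) with h | h
  · rw [limWeight_of_lt (Ioo_subset_Ioc_self hk) hq.1 h, max_eq_left (by linarith)]
    ring
  · rw [limWeight_of_le h, max_eq_right (by linarith)]
    simp

lemma integrableOn_indicator_Finv_div {k : ℝ} (hk : k ∈ Ioo (0 : ℝ) 1) {w : ℝ → ℝ}
    (hw : Measurable w) (hb : ∀ q ∈ Ioo (0 : ℝ) 1, |w q| ≤ 1) :
    IntegrableOn ((Iio (1 - k)).indicator fun q => D.Finv q * (w q / (1 - q) ^ 2)) (Ioo 0 1) := by
  have hk0 := hk.1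
  refine (D.integrableOn_Finv.const_mul (1 / k ^ 2)).mono'
    ((D.aestronglyMeasurable_Finv_mul (by fun_prop)).indicator measurableSet_Iio) ?_
  filter_upwards [ae_restrict_mem measurableSet_Ioo] with q hq
  have hF := D.Finv_pos hq
  by_cases h : q ∈ Iio (1 - k)
  · rw [indicator_of_mem h, norm_mul, norm_div, Real.norm_of_nonneg hF.le, mul_comm]
    have h1 : k < 1 - q := by linarith [mem_Iio.1 h]
    rw [Real.norm_of_nonneg (sq_nonneg (1 - q))]
    have h2 : ‖w q‖ ≤ 1 := hb q hq
    gcongr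
  · rw [indicator_of_notMem h, norm_zero]
    positivity

lemma integrableOn_phiFactor {k : ℝ} (hk : k ∈ Ioo (0 : ℝ) 1) :
    IntegrableOn (fun q => D.Finv q * (max (1 - q - k) 0 / (1 - q) ^ 2)) (Ioo 0 1) := by
  refine (D.integrableOn_indicator_Finv_div hk (w := fun q => max (1 - q - k) 0)
    (by fun_prop) ?_).congr (Eventually.of_forall fun q => ?_)
  · intro q hq
    rw [abs_of_nonneg (le_max_right _ _)]
    exact max_le (by linarith [hq.1, hk.1]) zero_le_one
  · by_cases h : q < 1 - k
    · rw [indicator_of_mem (show q ∈ Iio (1 - k) from h)]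
    · rw [indicator_of_notMem (show q ∉ Iio (1 - k) from h)]
      simp [max_eq_right (show 1 - q - k ≤ 0 by linarith)]

/-- The integrand has a kink in `k` at `q = 1 - k`, a null set of `q`, so the Lipschitz form of
differentiation under the integral is used. -/
lemma hasDerivAt_phiFactor {k : ℝ} (hk : k ∈ Ioo (0 : ℝ) 1) :
    HasDerivAt D.phiFactor (∫ q in Ioo (0 : ℝ) 1,
      (Iio (1 - k)).indicator (fun q => D.Finv q * (-1 / (1 - q) ^ 2)) q) k := by
  have hk0 := hk.1
  have hint := D.integrableOn_indicator_Finv_div hk (w := fun _ => -1) measurable_const (by simp)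
  refine (hasDerivAt_integral_of_dominated_loc_of_lip (s := Ioi (k / 2))
    (bound := fun q => 1 / (k / 2) ^ 2 * D.Finv q) (Ioi_mem_nhds (by linarith)) ?_ ?_ ?_ ?_ ?_ ?_).2
  · exact Eventually.of_forall fun x => D.aestronglyMeasurable_Finv_mul (by fun_prop)
  · exact D.integrableOn_phiFactor hk
  · exact hint.aestronglyMeasurable
  · filter_upwards [ae_restrict_mem measurableSet_Ioo] with q hq
    have hF := D.Finv_pos hq
    have h1 : 0 < 1 - q := sub_pos.2 hq.2
    refine LipschitzOnWith.of_dist_le_mul fun x hx y hy => ?_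
    rw [Real.coe_nnabs, abs_of_nonneg (by positivity), Real.dist_eq, Real.dist_eq, ← mul_sub,
      ← sub_div, abs_mul, abs_div, abs_of_pos hF, abs_of_pos (by positivity : 0 < (1 - q) ^ 2)]
    have hxy : |max (1 - q - x) 0 - max (1 - q - y) 0| ≤ |x - y| := by
      refine (abs_max_sub_max_le_abs _ _ _).trans_eq ?_
      rw [abs_sub_comm x y]
      congr 1
      ring
    -- For `x, y > k/2` the integrand vanishes when `1 - q ≤ k/2`; otherwise `(1-q)²` is bounded
    -- below by `(k/2)²`.
    rcases le_total (1 - q) (k / 2) with h | h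
    · rw [max_eq_right (by linarith [mem_Ioi.1 hx]), max_eq_right (by linarith [mem_Ioi.1 hy]),
        sub_self, abs_zero, zero_div, mul_zero]
      positivity
    · calc D.Finv q * (|max (1 - q - x) 0 - max (1 - q - y) 0| / (1 - q) ^ 2)
          ≤ D.Finv q * (|x - y| / (k / 2) ^ 2) := by gcongr
        _ = 1 / (k / 2) ^ 2 * D.Finv q * |x - y| := by ring
  · exact D.integrableOn_Finv.const_mul _
  · have hne : ∀ᵐ q ∂(volume.restrict (Ioo (0 : ℝ) 1)), q ≠ 1 - k :=
      ae_restrict_of_ae (Measure.ae_ne volume _)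
    filter_upwards [ae_restrict_mem measurableSet_Ioo, hne] with q hq hqk
    rcases lt_or_gt_of_ne hqk with h | h
    · rw [indicator_of_mem (show q ∈ Iio (1 - k) from h)]
      have h1 : HasDerivAt (fun x => D.Finv q * ((1 - q - x) / (1 - q) ^ 2))
          (D.Finv q * (-1 / (1 - q) ^ 2)) k :=
        ((((hasDerivAt_id k).const_sub (1 - q)).div_const _).const_mul _)
      refine h1.congr_of_eventuallyEq ?_
      filter_upwards [Iio_mem_nhds (show k < 1 - q by linarith)] with x hx
      rw [max_eq_left (by linarith [mem_Iio.1 hx])]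
    · rw [indicator_of_notMem (show q ∉ Iio (1 - k) from not_lt.2 h.le)]
      refine (hasDerivAt_const k (0 : ℝ)).congr_of_eventuallyEq ?_
      filter_upwards [Ioi_mem_nhds (show 1 - q < k by linarith)] with x hx
      rw [max_eq_right (by linarith [mem_Ioi.1 hx])]
      simp

lemma firstOrder_of_isMaxOn {k : ℝ} (hk : k ∈ Ioo (0 : ℝ) 1) (h : IsMaxOn D.phi (Ioo 0 1) k) :
    D.FirstOrder k := by
  have hk0 := hk.1
  have hk1 : 0 < 1 - k := sub_pos.2 hk.2
  have hnhds : Ioo (0 : ℝ) 1 ∈ 𝓝 k := Ioo_mem_nhds hk.1 hk.2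
  have hd1 : HasDerivAt (fun k : ℝ => k / (1 - k)) (1 / (1 - k) ^ 2) k := by
    refine ((hasDerivAt_id k).div ((hasDerivAt_id k).const_sub 1) hk1.ne').congr_deriv ?_
    simp
  have hd : HasDerivAt D.phi _ k := (hd1.mul (D.hasDerivAt_phiFactor hk)).congr_of_eventuallyEq
    (by filter_upwards [hnhds] with x hx using D.phi_eq_mul_phiFactor hx)
  have hzero := (h.isLocalMax hnhds).hasDerivAt_eq_zero hd
  have hi1 := D.integrableOn_indicator_Finv_div hk (w := fun _ => -1) measurable_const (by simp)
  have hi2 := D.integrableOn_phiFactor hk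
  have hsub := intervalIntegral.integral_comp_sub_left (a := k) (b := 1)
    (fun q => D.Finv q * (1 / (1 - q) - (2 * k - k ^ 2) / (1 - q) ^ 2)) 1
  simp only [sub_sub_cancel, sub_self] at hsub
  rw [FirstOrder, hsub, ← setIntegral_indicator_Iio (Ioo_subset_Ioc_self hk)]
  -- After clearing `(1-k)²`, the vanishing derivative reads `G + k(1-k) G' = 0` with `G =
  -- phiFactor`. The integrands match because `(1-q-k) - k(1-k) = (1-q) - (2k-k²)`.
  have heq : ∫ q in Ioo (0 : ℝ) 1, (Iio (1 - k)).indicator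
      (fun q => D.Finv q * (1 / (1 - q) - (2 * k - k ^ 2) / (1 - q) ^ 2)) q
      = D.phiFactor k + k * (1 - k) * ∫ q in Ioo (0 : ℝ) 1,
        (Iio (1 - k)).indicator (fun q => D.Finv q * (-1 / (1 - q) ^ 2)) q := by
    rw [phiFactor, ← integral_const_mul, ← integral_add hi2 (hi1.const_mul _)]
    refine setIntegral_congr_fun measurableSet_Ioo fun q hq => ?_
    have h1q : 1 - q ≠ 0 := (sub_pos.2 hq.2).ne'
    by_cases h : q < 1 - k
    · simp only [indicator_of_mem (show q ∈ Iio (1 - k) from h)]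
      rw [max_eq_left (by linarith)]
      field_simp
      ring
    · simp only [indicator_of_notMem (show q ∉ Iio (1 - k) from h)]
      rw [max_eq_right (by linarith)]
      simp
  rw [heq]
  generalize ∫ q in Ioo (0 : ℝ) 1,
    (Iio (1 - k)).indicator (fun q => D.Finv q * (-1 / (1 - q) ^ 2)) q = Q at hzero ⊢
  field_simp at hzero
  linarith

/-! ### Asymptotics of optimal sizes -/

lemma exists_natCast_div_near {k : ℝ} (hk : k ∈ Ioo (0 : ℝ) 1) {U : Set ℝ} (hU : U ∈ 𝓝 k) :
    ∃ N : ℕ, ∀ n : ℕ, N ≤ n → ∃ m : ℕ, 2 ≤ m ∧ m ≤ n ∧ (m : ℝ) / n ∈ U := by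
  have h1 : Tendsto (fun n : ℕ => (⌈k * n⌉₊ : ℝ) / n) atTop (𝓝 k) :=
    (tendsto_nat_ceil_mul_div_atTop hk.1.le).comp tendsto_natCast_atTop_atTop
  have h2 : Tendsto (fun n : ℕ => k * n) atTop atTop :=
    tendsto_natCast_atTop_atTop.const_mul_atTop hk.1
  obtain ⟨N, hN⟩ := eventually_atTop.1 ((h1.eventually hU).and (h2.eventually_ge_atTop 2))
  refine ⟨N, fun n hn => ⟨⌈k * n⌉₊, ?_, ?_, (hN n hn).1⟩⟩
  · have := (hN n hn).2.trans (Nat.le_ceil _)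
    exact_mod_cast this
  · exact Nat.ceil_le.2 (mul_le_of_le_one_left (Nat.cast_nonneg n) hk.2.le)

lemma exists_isMaxOn_near_of_isOptimalSize {ε : ℝ} (hε : 0 < ε) : ∃ N : ℕ, ∀ n : ℕ, N ≤ n →
    ∀ m : ℕ, D.IsOptimalSize n m →
      ∃ k ∈ Ioo (0 : ℝ) 1, IsMaxOn D.phi (Ioo 0 1) k ∧ |(m : ℝ) / n - k| < ε := by
  obtain ⟨k₀, hk₀, hmax⟩ := D.exists_isMaxOn_phiExt
  have hpos : 0 < D.phiExt k₀ :=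
    D.phiExt_half_pos.trans_le (hmax (show (1 / 2 : ℝ) ∈ Icc (0 : ℝ) 1 by norm_num))
  -- Taken inside the closed interval so as to be compact; it can contain the endpoints, where
  -- `phiExt` is `0` and hence below its maximum.
  set far : Set ℝ := {x | x ∈ Icc (0 : ℝ) 1 ∧
    ∀ k ∈ Ioo (0 : ℝ) 1, IsMaxOn D.phi (Ioo 0 1) k → ε ≤ |x - k|} with hfar
  have hfarc : IsCompact far := by
    refine isCompact_Icc.of_isClosed_subset ?_ fun x hx => hx.1
    have : far = Icc (0 : ℝ) 1 ∩ ⋂ k ∈ Ioo (0 : ℝ) 1, ⋂ _ : IsMaxOn D.phi (Ioo 0 1) k,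
        {x | ε ≤ |x - k|} := by
      ext x
      simp [hfar]
    rw [this]
    refine isClosed_Icc.inter (isClosed_biInter fun k _ => isClosed_iInter fun _ => ?_)
    exact isClosed_le continuous_const (by fun_prop)
  obtain ⟨M, hM, hMfar⟩ : ∃ M < D.phiExt k₀, ∀ x ∈ far, D.phiExt x ≤ M := by
    rcases far.eq_empty_or_nonempty with h | h
    · exact ⟨0, hpos, by simp [h]⟩
    obtain ⟨k₁, hk₁, hmax₁⟩ := hfarc.exists_isMaxOn h
      (D.continuousOn_phiExt.mono fun x hx => hx.1)
    refine ⟨D.phiExt k₁, lt_of_le_of_ne (hmax hk₁.1) fun heq => ?_, hmax₁⟩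
    have h0 : 0 < k₁ := lt_of_le_of_ne hk₁.1.1 fun h => by
      rw [← heq, ← h, phiExt_zero] at hpos
      exact lt_irrefl _ hpos
    have h1 : k₁ < 1 := lt_of_le_of_ne hk₁.1.2 fun h => by
      rw [← heq, h, phiExt_one] at hpos
      exact lt_irrefl _ hpos
    have h2 : IsMaxOn D.phiExt (Icc 0 1) k₁ := fun x hx => (hmax hx).trans_eq heq.symm
    have := hk₁.2 k₁ ⟨h0, h1⟩ (D.isMaxOn_phi_of_isMaxOn_phiExt ⟨h0, h1⟩ h2)
    rw [sub_self, abs_zero] at this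
    exact absurd hε (not_lt.2 this)
  -- If an optimal `m/n` were in `far`, comparison with some `m'/n` near `k₀` would give `max - 2η <
  -- M + η`: one `η` for each approximation of `S/n` and one for continuity at `k₀`. This
  -- contradicts `max - M = 4η`.
  set η := (D.phiExt k₀ - M) / 4 with hη
  have hη0 : 0 < η := by rw [hη]; linarith
  obtain ⟨N₁, hN₁⟩ := D.exists_abs_S_div_sub_phiExt_le hη0
  have hU : {x | D.phiExt k₀ - η < D.phiExt x} ∈ 𝓝 k₀ := by
    have hc : ContinuousAt D.phiExt k₀ :=
      D.continuousOn_phiExt.continuousAt (Icc_mem_nhds hk₀.1 hk₀.2)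
    exact hc.eventually (Ioi_mem_nhds (by linarith))
  obtain ⟨N₂, hN₂⟩ := exists_natCast_div_near hk₀ hU
  refine ⟨max N₁ N₂, fun n hn m hm => ?_⟩
  obtain ⟨m', hm'2, hm'n, hm'U⟩ := hN₂ n ((le_max_right _ _).trans hn)
  have hn0 : (0 : ℝ) < n := by exact_mod_cast (by omega : 0 < n)
  have h1 := abs_le.1 (hN₁ n ((le_max_left _ _).trans hn) m hm.1 hm.2.1)
  have h2 := abs_le.1 (hN₁ n ((le_max_left _ _).trans hn) m' hm'2 hm'n)
  have h3 : D.S m' n / n ≤ D.S m n / n := by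
    have := hm.2.2 m' hm'2 hm'n
    gcongr
  have h4 : D.phiExt k₀ - η < D.phiExt ((m' : ℝ) / n) := hm'U
  have h5 : (m : ℝ) / n ∉ far := fun h => by
    have := hMfar _ h
    have h6 : 4 * η = D.phiExt k₀ - M := by rw [hη]; ring
    linarith [h1.1, h1.2, h2.1, h2.2]
  have h6 : (m : ℝ) / n ∈ Icc (0 : ℝ) 1 :=
    ⟨by positivity, div_le_one_of_le₀ (by exact_mod_cast hm.2.1) hn0.le⟩
  by_contra! hcon
  exact h5 ⟨h6, fun k hk hkm => hcon k hk hkm⟩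

lemma exists_isMaxOn_phi : ∃ k ∈ Ioo (0 : ℝ) 1, IsMaxOn D.phi (Ioo 0 1) k := by
  obtain ⟨k, hk, hkm⟩ := D.exists_isMaxOn_phiExt
  exact ⟨k, hk, D.isMaxOn_phi_of_isMaxOn_phiExt hk hkm⟩

lemma tendsto_optimalSize_div {kstar : ℝ}
    (huniq : ∀ k ∈ Ioo (0 : ℝ) 1, IsMaxOn D.phi (Ioo 0 1) k → k = kstar)
    {mstar : ℕ → ℕ} (hopt : ∀ n, 2 ≤ n → D.IsOptimalSize n (mstar n)) :
    Tendsto (fun n => (mstar n : ℝ) / n) atTop (𝓝 kstar) := by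
  refine Metric.tendsto_atTop.2 fun ε hε => ?_
  obtain ⟨N, hN⟩ := D.exists_isMaxOn_near_of_isOptimalSize hε
  refine ⟨max N 2, fun n hn => ?_⟩
  obtain ⟨k, hk, hkm, hlt⟩ :=
    hN n ((le_max_left _ _).trans hn) _ (hopt n ((le_max_right _ _).trans hn))
  rwa [huniq k hk hkm] at hlt

end AbilityDistribution

end

theorem mainTheorem5 (D : AbilityDistribution) :
    -- uniform convergence in `k = m / n`
    (∀ ε : ℝ, 0 < ε → ∃ N : ℕ, ∀ n : ℕ, N ≤ n → ∀ m : ℕ, 2 ≤ m → m < n →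
      |D.S m n / n - D.phi ((m : ℝ) / n)| ≤ ε) ∧
    -- the limit function has a maximizer, and its maximizers solve the first-order equation
    (∃ k ∈ Ioo (0 : ℝ) 1, IsMaxOn D.phi (Ioo 0 1) k) ∧
    (∀ k ∈ Ioo (0 : ℝ) 1, IsMaxOn D.phi (Ioo 0 1) k → D.FirstOrder k) ∧
    -- optimal sizes, relative to `n`, approach the set of these maximizers
    (∀ ε : ℝ, 0 < ε → ∃ N : ℕ, ∀ n : ℕ, N ≤ n → ∀ m : ℕ, D.IsOptimalSize n m →
      ∃ k ∈ Ioo (0 : ℝ) 1, IsMaxOn D.phi (Ioo 0 1) k ∧ D.FirstOrder k ∧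
        |(m : ℝ) / n - k| < ε) ∧
    -- if the maximizer is unique, it is the limit of the optimal relative size
    ((∀ k₁ ∈ Ioo (0 : ℝ) 1, ∀ k₂ ∈ Ioo (0 : ℝ) 1,
        IsMaxOn D.phi (Ioo 0 1) k₁ → IsMaxOn D.phi (Ioo 0 1) k₂ → k₁ = k₂) →
      ∃ kstar ∈ Ioo (0 : ℝ) 1, D.FirstOrder kstar ∧ IsMaxOn D.phi (Ioo 0 1) kstar ∧
        ∀ mstar : ℕ → ℕ, (∀ n, 2 ≤ n → D.IsOptimalSize n (mstar n)) →
          Tendsto (fun n => (mstar n : ℝ) / n) atTop (𝓝 kstar)) ∧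
    -- in particular, this holds if the first-order equation has only one solution in `(0, 1)`
    (∀ kstar ∈ Ioo (0 : ℝ) 1, D.FirstOrder kstar →
      (∀ k ∈ Ioo (0 : ℝ) 1, D.FirstOrder k → k = kstar) →
        IsMaxOn D.phi (Ioo 0 1) kstar ∧
        ∀ mstar : ℕ → ℕ, (∀ n, 2 ≤ n → D.IsOptimalSize n (mstar n)) →
          Tendsto (fun n => (mstar n : ℝ) / n) atTop (𝓝 kstar)) := by
  refine ⟨fun ε hε => ?_, ?_, fun k hk h => D.firstOrder_of_isMaxOn hk h, fun ε hε => ?_, ?_, ?_⟩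
  · obtain ⟨N, hN⟩ := D.exists_abs_S_div_sub_phiExt_le hε
    refine ⟨N, fun n hn m hm hmn => ?_⟩
    have hm0 : (0 : ℝ) < m := by exact_mod_cast (by omega : 0 < m)
    have hn0 : (0 : ℝ) < n := by exact_mod_cast (by omega : 0 < n)
    rw [D.phi_eq_phiExt ⟨by positivity, div_le_one_of_le₀ (by exact_mod_cast hmn.le) hn0.le⟩]
    exact hN n hn m hm hmn.le
  · exact D.exists_isMaxOn_phi
  · obtain ⟨N, hN⟩ := D.exists_isMaxOn_near_of_isOptimalSize hε
    refine ⟨N, fun n hn m hm => ?_⟩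
    obtain ⟨k, hk, hkm, hlt⟩ := hN n hn m hm
    exact ⟨k, hk, hkm, D.firstOrder_of_isMaxOn hk hkm, hlt⟩
  · intro huniq
    obtain ⟨k, hk, hkm⟩ := D.exists_isMaxOn_phi
    exact ⟨k, hk, D.firstOrder_of_isMaxOn hk hkm, hkm, fun mstar hopt =>
      D.tendsto_optimalSize_div (fun k' hk' hkm' => huniq k' hk' k hk hkm' hkm) hopt⟩
  · intro kstar hks _ huniq
    have h : ∀ k ∈ Ioo (0 : ℝ) 1, IsMaxOn D.phi (Ioo 0 1) k → k = kstar := fun k hk hkm =>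
      huniq k hk (D.firstOrder_of_isMaxOn hk hkm)
    obtain ⟨k, hk, hkm⟩ := D.exists_isMaxOn_phi
    exact ⟨h k hk hkm ▸ hkm, fun mstar hopt => D.tendsto_optimalSize_div h hopt⟩
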